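/- Let $d\ge 1$, $\mu\in\mathbb R$, let $f:\mathbb R^d\to\mathbb R^d$ be smooth, and consider the lattice system $$U_j'(t)=\mu\,[U_{j+1}(t)-2U_j(t)+U_{j-1}(t)]+f(U_j(t)),\qquad j\in\mathbb Z.$$ Let $N\ge 1$ be an integer and $\underline k=1/N$. Let $(u^k,\omega(k))$, for $k$ in an open neighborhood of $\underline k$, be a smooth family (jointly in $k$ and the phase $\zeta$) of one-periodic profiles $u^k:\mathbb R\to\mathbb R^d$ and frequencies $\omega(k)\in\mathbb R$ such that $U_j(t)=u^k(kj+\omega(k)t)$ solves the system, i.e. $$\omega(k)\,\partial_\zeta u^k=\mu\,[u^k(\cdot+k)-2u^k+u^k(\cdot-k)]+f(u^k).$$ Write $u=u^{\underline k}$, $\omega=\omega(\underline k)$ and assume $\omega\neq 0$. For $\xi\in\mathbb R$ let $A_\xi(t)$ be the Bloch symbol of the linearization about $U_j(t)=u(\underline kj+\omega t)$, acting on $(\mathbb C^d)^{\mathbb Z/N\mathbb Z}$ by $$(A_\xi(t)V)_j=\mu\,[e^{i\xi}V_{j+1}-2V_j+e^{-i\xi}V_{j-1}]+Df(u(\underline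 kj+\omega t))V_j,$$ and let $S_\xi(t,s)$ be the evolution system that it generates. Assume that the wave is nondegenerate (assumption A): the sequence $(u'(j/N))_{j\in\mathbb Z/N\mathbb Z}$ is a basis of the generalized kernel of $S_0(1/\omega,0)-\mathrm{Id}$. Then there is $u^{\rm ad}\in H^1_{per}([0,1];\mathbb C^d)$ that spans the kernel of the operator $L^*w=\omega w'+\mu[w(\cdot-\underline k)-2w+w(\cdot+\underline k)]+Df(u)^{T}w$ (with domain $H^1_{per}$; the adjoint of the linearized profile operator) and satisfies $\langle u^{\rm ad},u'\rangle=1$ in $L^2_{per}([0,1])$. Moreover there are $\epsilon_0>0$, $\xi_0\in(0,\pi/N)$ and an analytic curve $\lambda:[-\xi_0,\xi_0]\to\mathbb C$ such that, for all $\xi\in[-\xi_0,\xi_0]$, $$\sigma(S_\xi(1/\omega,0))\cap B(1,\epsilon_0)=\{\lambda(\xi)\},$$ the eigenvalue $\lambda(\xi)$ of $S_\xi(1/\omega,0)$ is (algebraically) simple, and, if the parametrization of the family is normalized by $\langle u^{\rm ad},\partial_ku^k|_{k=\underline k}\rangle=0$, then as $\xi\to0$ $$\lambda(\xi)=\exp\Big(\tfrac1\omega\big(i\xi\,\partial_k\omega(\underline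 k)+(i\xi)^2\,d(\underline k)\big)\Big)+O(|\xi|^3),$$ where $$d(\underline k)=\Big\langle u^{\rm ad},\ \mu\,[\partial_ku^{\underline k}(\cdot+\underline k)-\partial_ku^{\underline k}(\cdot-\underline k)]+\tfrac12\mu\,[\partial_\zeta u^{\underline k}(\cdot+\underline k)+\partial_\zeta u^{\underline k}(\cdot-\underline k)]\Big\rangle .$$ -/

import Mathlib

open Set Filter Topology MeasureTheory
open scoped ComplexConjugate

noncomputable section

namespace LatticeRD

/-! ### Evolution systems of bounded linear non-autonomous equations -/

section Evolution

variable {X : Type*} [NormedAddCommGroup X] [NormedSpace ℂ X]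

/-- Terms of the Peano–Baker (Picard) series of `V' = A(t) V` started at time `s`. -/
def peanoBaker (A : ℝ → X →L[ℂ] X) (s : ℝ) : ℕ → ℝ → X →L[ℂ] X
  | 0 => fun _ => 1
  | n + 1 => fun t => ∫ r in s..t, A r * peanoBaker A s n r

/-- The evolution system `S(t,s)` generated by `A(·)`: the unique solution of
`∂ₜ S(t,s) = A(t) S(t,s)`, `S(s,s) = Id`, given by its Peano–Baker series
(see `evolution_self` and `hasDerivAt_evolution`). -/
def evolution (A : ℝ → X →L[ℂ] X) (t s : ℝ) : X →L[ℂ] X :=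
  ∑' n, peanoBaker A s n t

theorem continuous_peanoBaker {A : ℝ → X →L[ℂ] X} (hA : Continuous A) (s : ℝ) (n : ℕ) :
    Continuous (peanoBaker A s n) := by
  induction n with
  | zero => exact continuous_const
  | succ n ih =>
    exact intervalIntegral.continuous_primitive
      (fun a b => (hA.mul ih).intervalIntegrable a b) s

theorem evolution_self (A : ℝ → X →L[ℂ] X) (s : ℝ) : evolution A s s = 1 := by
  unfold evolution
  rw [tsum_eq_single 0]
  · rfl
  · intro n hn
    obtain ⟨m, rfl⟩ := Nat.exists_eq_succ_of_ne_zero hn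
    simp [peanoBaker]

theorem norm_peanoBaker_le {A : ℝ → X →L[ℂ] X} (s R M : ℝ)
    (hs : |s| ≤ R) (hM : ∀ r, |r| ≤ R → ‖A r‖ ≤ M) (n : ℕ) :
    ∀ t, |t| ≤ R →
      ‖peanoBaker A s n t‖ ≤ ‖(1 : X →L[ℂ] X)‖ * ((M * |t - s|) ^ n / n.factorial) := by
  have hM0 : 0 ≤ M := (norm_nonneg _).trans (hM s hs)
  induction n with
  | zero => intro t _; simp [peanoBaker]
  | succ n ih =>
    intro t ht
    have key : ‖∫ r in s..t, A r * peanoBaker A s n r‖ ≤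
        |∫ r in s..t, M * (‖(1 : X →L[ℂ] X)‖ * ((M * |r - s|) ^ n / n.factorial))| := by
      apply intervalIntegral.norm_integral_le_abs_of_norm_le
      · refine ae_restrict_of_forall_mem measurableSet_uIoc fun r hr => ?_
        have hr' : |r| ≤ R := by
          rw [abs_le] at *
          rcases le_total s t with h | h
          · rw [uIoc_of_le h] at hr; exact ⟨by linarith [hr.1], by linarith [hr.2]⟩
          · rw [uIoc_of_ge h] at hr; exact ⟨by linarith [hr.1], by linarith [hr.2]⟩
        refine (norm_mul_le _ _).trans ?_
        exact mul_le_mul (hM r hr') (ih r hr') (norm_nonneg _) hM0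
      · exact Continuous.intervalIntegrable (by fun_prop) _ _
    refine key.trans (le_of_eq ?_)
    have h1 : ∀ r, M * (‖(1 : X →L[ℂ] X)‖ * ((M * |r - s|) ^ n / n.factorial)) =
        (‖(1 : X →L[ℂ] X)‖ * M ^ (n + 1) / n.factorial) * |r - s| ^ n := by
      intro r; rw [mul_pow]; ring
    simp_rw [h1]
    rw [intervalIntegral.integral_const_mul, abs_mul, abs_of_nonneg (by positivity)]
    have h2 : |∫ r in s..t, |r - s| ^ n| = |t - s| ^ (n + 1) / (n + 1) := by
      rw [intervalIntegral.abs_integral_eq_abs_integral_uIoc,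
        abs_of_nonneg (integral_nonneg fun r => by positivity),
        integral_pow_abs_sub_uIoc]
    rw [h2, mul_pow, Nat.factorial_succ]
    push_cast
    field_simp

theorem hasDerivAt_peanoBaker_succ [CompleteSpace X] {A : ℝ → X →L[ℂ] X} (hA : Continuous A)
    (s : ℝ) (n : ℕ) (t : ℝ) :
    HasDerivAt (peanoBaker A s (n + 1)) (A t * peanoBaker A s n t) t := by
  have hc : Continuous fun r => A r * peanoBaker A s n r := hA.mul (continuous_peanoBaker hA s n)
  exact intervalIntegral.integral_hasDerivAt_right (hc.intervalIntegrable s t)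
    (hc.stronglyMeasurableAtFilter volume (𝓝 t)) hc.continuousAt

set_option maxHeartbeats 1000000 in
/-- The Peano–Baker series solves the differential equation. -/
theorem hasDerivAt_evolution [CompleteSpace X] {A : ℝ → X →L[ℂ] X} (hA : Continuous A)
    (t s : ℝ) :
    HasDerivAt (fun t => evolution A t s) (A t * evolution A t s) t := by
  set R : ℝ := |s| + |t| + 1 with hR
  obtain ⟨M, hM⟩ := (isCompact_Icc (a := -R) (b := R)).exists_bound_of_continuousOn hA.continuousOn
  have hM' : ∀ r, |r| ≤ R → ‖A r‖ ≤ M := fun r hr => hM r (abs_le.1 hr)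
  have hsR : |s| ≤ R := by rw [hR]; linarith [abs_nonneg t]
  have hM0 : 0 ≤ M := (norm_nonneg _).trans (hM' s hsR)
  have hb : ∀ n r, |r| ≤ R → ‖peanoBaker A s n r‖ ≤
      ‖(1 : X →L[ℂ] X)‖ * ((M * (2 * R)) ^ n / n.factorial) := by
    intro n r hr
    refine (norm_peanoBaker_le s R M hsR hM' n r hr).trans ?_
    have : |r - s| ≤ 2 * R := (abs_sub r s).trans (by linarith)
    gcongr
  have hsum : Summable fun n : ℕ => ‖(1 : X →L[ℂ] X)‖ * ((M * (2 * R)) ^ n / n.factorial) :=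
    (Real.summable_pow_div_factorial _).mul_left _
  have htR : |t| < R := by rw [hR]; linarith [abs_nonneg s]
  have hS : ∀ r, |r| ≤ R → Summable fun n => peanoBaker A s n r := fun r hr =>
    Summable.of_norm_bounded hsum fun n => hb n r hr
  have hd := hasDerivAt_tsum_of_isPreconnected
    (g := fun n r => peanoBaker A s (n + 1) r)
    (g' := fun n r => A r * peanoBaker A s n r)
    (u := fun n => M * (‖(1 : X →L[ℂ] X)‖ * ((M * (2 * R)) ^ n / n.factorial)))
    (t := Ioo (-R) R) (y₀ := t) (y := t) (hsum.mul_left M) isOpen_Ioo isPreconnected_Ioo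
    (fun n y _ => hasDerivAt_peanoBaker_succ hA s n y)
    (fun n y hy => by
      have hy' : |y| ≤ R := abs_le.2 ⟨hy.1.le, hy.2.le⟩
      exact (norm_mul_le _ _).trans
        (mul_le_mul (hM' y hy') (hb n y hy') (norm_nonneg _) hM0))
    (abs_lt.1 htR) ((summable_nat_add_iff 1).2 (hS t htR.le)) (abs_lt.1 htR)
  have hval : ∑' n, A t * peanoBaker A s n t = A t * evolution A t s :=
    (hS t htR.le).tsum_mul_left (A t)
  rw [hval] at hd
  have hd' := (hasDerivAt_const t (1 : X →L[ℂ] X)).add hd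
  rw [zero_add] at hd'
  refine hd'.congr_of_eventuallyEq ?_
  filter_upwards [Ioo_mem_nhds (abs_lt.1 htR).1 (abs_lt.1 htR).2] with r hr
  have hr' : |r| ≤ R := abs_le.2 ⟨hr.1.le, hr.2.le⟩
  exact (hS r hr').tsum_eq_zero_add

end Evolution

/-! ### Periodic traveling waves of
`U_j' = μ (U_{j+1} - 2 U_j + U_{j-1}) + f (U_j)`, `j ∈ ℤ` -/

section Waves

variable {d : ℕ}

/-- `u k`, `ω k`, for `k ∈ I`, is a smooth family of profiles and time frequencies, parametrized by
the wavenumber `k`, of periodic traveling waves `U_j(t) = u k (k j + ω(k) t)`. -/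
structure IsWaveFamily (μ : ℝ) (f : (Fin d → ℝ) → Fin d → ℝ) (I : Set ℝ)
    (u : ℝ → ℝ → Fin d → ℝ) (ω : ℝ → ℝ) : Prop where
  smooth_profile : ContDiffOn ℝ ((⊤ : ℕ∞) : WithTop ℕ∞) (fun p : ℝ × ℝ => u p.1 p.2) (I ×ˢ univ)
  smooth_freq : ContDiffOn ℝ ((⊤ : ℕ∞) : WithTop ℕ∞) ω I
  periodic : ∀ k ∈ I, Function.Periodic (u k) 1
  profile_eq : ∀ k ∈ I, ∀ ζ : ℝ,
    ω k • deriv (u k) ζ = μ • (u k (ζ + k) - (2 : ℝ) • u k ζ + u k (ζ - k)) + f (u k ζ)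

/-- Complexification of a real vector. -/
def toC (v : Fin d → ℝ) : Fin d → ℂ := fun a => (v a : ℂ)

/-- The Jacobian matrix of `f` at `x`, as a complex matrix. -/
def jac (f : (Fin d → ℝ) → Fin d → ℝ) (x : Fin d → ℝ) : Matrix (Fin d) (Fin d) ℂ :=
  Matrix.of fun a b => ((fderiv ℝ f x (Pi.single b 1) a : ℝ) : ℂ)

/-- The lattice system linearized about the wave `U_j(t) = u (k j + ω t)`:
`(A(t) V)_j = μ (V_{j+1} - 2 V_j + V_{j-1}) + Df(U_j(t)) V_j`. -/
def linearization (μ : ℝ) (f : (Fin d → ℝ) → Fin d → ℝ) (u : ℝ → Fin d → ℝ) (k ω t : ℝ) :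
    (ℤ → Fin d → ℂ) →ₗ[ℂ] (ℤ → Fin d → ℂ) where
  toFun V := fun j => (μ : ℂ) • (V (j + 1) - (2 : ℂ) • V j + V (j - 1)) +
    (jac f (u (k * j + ω * t))).mulVec (V j)
  map_add' V W := by
    funext j
    simp only [Pi.add_apply, Matrix.mulVec_add, smul_add, smul_sub]
    abel
  map_smul' c V := by
    funext j
    simp only [Pi.smul_apply, Matrix.mulVec_smul, RingHom.id_apply, smul_add, smul_sub,
      smul_comm c]

variable (N : ℕ)

/-- The sequence `j ↦ e^{i j ξ} g_j` on `ℤ`, for `g` on `ℤ/Nℤ`. -/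
def modulate (ξ : ℝ) : (ZMod N → Fin d → ℂ) →ₗ[ℂ] (ℤ → Fin d → ℂ) where
  toFun g := fun j => Complex.exp (Complex.I * j * ξ) • g (j : ZMod N)
  map_add' g h := by funext j; simp only [Pi.add_apply, smul_add]
  map_smul' c g := by funext j; simp only [Pi.smul_apply, RingHom.id_apply, smul_comm c]

/-- The discrete Bloch symbol `A_ξ = e^{-i · ξ} A e^{i · ξ}` at Floquet exponent `ξ` of an
`N`-periodic operator `A` on sequences; the value at a class mod `N` is read at its representative
in `{0, …, N-1}`. -/
def blochSymbol [NeZero N] (ξ : ℝ) (A : (ℤ → Fin d → ℂ) →ₗ[ℂ] (ℤ → Fin d → ℂ)) :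
    (ZMod N → Fin d → ℂ) →L[ℂ] (ZMod N → Fin d → ℂ) :=
  LinearMap.toContinuousLinearMap
    { toFun := fun g j => Complex.exp (-(Complex.I * (j.val : ℂ) * ξ)) •
        A (modulate N ξ g) (j.val : ℤ)
      map_add' := fun g h => by funext j; simp only [map_add, Pi.add_apply, smul_add]
      map_smul' := fun c g => by
        funext j
        simp only [map_smul, Pi.smul_apply, RingHom.id_apply, smul_comm c] }

/-- The one-period Floquet operator `S_ξ(1/ω, 0)` at Floquet exponent `ξ` of the lattice system
linearized about the wave of wavenumber `1/N` with profile `u` and frequency `ω`. -/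
def floquet [NeZero N] (μ : ℝ) (f : (Fin d → ℝ) → Fin d → ℝ) (u : ℝ → Fin d → ℝ) (ω : ℝ) (ξ : ℝ) :
    (ZMod N → Fin d → ℂ) →L[ℂ] (ZMod N → Fin d → ℂ) :=
  evolution (fun t => blochSymbol N ξ (linearization μ f u (1 / N) ω t)) (1 / ω) 0

/-- The generalized eigenspace of an operator `S` for the eigenvalue `z`. -/
def genEigenspace [NeZero N] (S : (ZMod N → Fin d → ℂ) →L[ℂ] (ZMod N → Fin d → ℂ)) (z : ℂ) :
    Submodule ℂ (ZMod N → Fin d → ℂ) :=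
  Module.End.maxGenEigenspace (S : (ZMod N → Fin d → ℂ) →ₗ[ℂ] (ZMod N → Fin d → ℂ)) z

/-- The `N`-periodic sequence `j ↦ u'(j/N)`, i.e. the time-translation mode at time `0`. -/
def translationMode (u : ℝ → Fin d → ℝ) : ZMod N → Fin d → ℂ :=
  fun j => toC (deriv u ((1 / N : ℝ) * j.val))

/-- Nondegeneracy of the wave of wavenumber `1/N`: the time-translation mode is a basis of the
generalized kernel of `S_0(1/ω, 0) - Id`. -/
def Nondegenerate [NeZero N] (μ : ℝ) (f : (Fin d → ℝ) → Fin d → ℝ) (u : ℝ → Fin d → ℝ) (ω : ℝ) :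
    Prop :=
  translationMode N u ≠ 0 ∧
    genEigenspace N (floquet N μ f u ω 0) 1 = Submodule.span ℂ {translationMode N u}

/-! ### The adjoint mode and the diffusion coefficient -/

/-- `v ∈ H¹_per([0,1]; ℂ^d)`, given by its continuous representative, with weak derivative `g`. -/
structure IsH1Per (v g : ℝ → Fin d → ℂ) : Prop where
  periodic : Function.Periodic v 1
  periodic_deriv : Function.Periodic g 1
  memLp : MemLp g 2 (volume.restrict (Ioc (0 : ℝ) 1))
  integral_eq : ∀ a b : ℝ, ∫ x in a..b, g x = v b - v a

/-- The scalar product of `L²_per([0,1]; ℂ^d)`, antilinear in the first variable. -/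
def inner01 (v w : ℝ → Fin d → ℂ) : ℂ :=
  ∫ ζ in (0 : ℝ)..1, ∑ a, conj (v ζ a) * w ζ a

/-- `w` belongs to the kernel of the adjoint, with domain `H¹_per`,
`L* w = ω w' + μ (w(· - k) - 2 w + w(· + k)) + Df(u)ᵀ w` of
`L v = -ω v' + μ (v(· + k) - 2 v + v(· - k)) + Df(u) v`. -/
def InKerAdjoint (μ : ℝ) (f : (Fin d → ℝ) → Fin d → ℝ) (u : ℝ → Fin d → ℝ) (k ω : ℝ)
    (w : ℝ → Fin d → ℂ) : Prop :=
  ∃ g : ℝ → Fin d → ℂ, IsH1Per w g ∧ ∀ᵐ ζ : ℝ,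
    (ω : ℂ) • g ζ + (μ : ℂ) • (w (ζ - k) - (2 : ℂ) • w ζ + w (ζ + k)) +
      (jac f (u ζ)).transpose.mulVec (w ζ) = 0

/-- `w` spans the kernel of `L*` and `⟨w, u'⟩ = 1`. -/
def IsAdjointMode (μ : ℝ) (f : (Fin d → ℝ) → Fin d → ℝ) (u : ℝ → Fin d → ℝ) (k ω : ℝ)
    (w : ℝ → Fin d → ℂ) : Prop :=
  InKerAdjoint μ f u k ω w ∧
    (∀ v, InKerAdjoint μ f u k ω v → ∃ c : ℂ, v = c • w) ∧
    inner01 w (fun ζ => toC (deriv u ζ)) = 1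

/-- `∂_ζ u^k`. -/
def dζ (u : ℝ → ℝ → Fin d → ℝ) (k ζ : ℝ) : Fin d → ℂ := toC (deriv (u k) ζ)

/-- `∂_k u^k`. -/
def dk (u : ℝ → ℝ → Fin d → ℝ) (k ζ : ℝ) : Fin d → ℂ := toC (deriv (fun κ => u κ ζ) k)

/-- The diffusion coefficient
`d(k) = ⟨w, μ [∂_k u(· + k) - ∂_k u(· - k)] + ½ μ [∂_ζ u(· + k) + ∂_ζ u(· - k)]⟩`,
with `w` the adjoint mode. -/
def diffusionCoeff (μ : ℝ) (u : ℝ → ℝ → Fin d → ℝ) (k : ℝ) (w : ℝ → Fin d → ℂ) : ℂ :=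
  inner01 w fun ζ =>
    (μ : ℂ) • (dk u k (ζ + k) - dk u k (ζ - k)) +
      ((1 / 2 : ℂ) * μ) • (dζ u k (ζ + k) + dζ u k (ζ - k))

end Waves

end LatticeRD

end

noncomputable section

namespace LatticeRD

/-! ### Linear non-autonomous equations -/

section LinearODE

variable {X : Type*} [NormedAddCommGroup X] [NormedSpace ℂ X]

/-! Measured in the phase ζ = ωt, the Floquet operator is the time-one map `S x`, at x = iξ, of a
generator A(t) + C(x), where A is 1-periodic and C(x) = (μ/ω)((e^x - 1)T + (e^{-x} - 1)T⁻¹), T being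
the shift on ℤ/N. Let x be any complex number: `S x` is then entire in x
(`differentiable_evolution`), and nondegeneracy says that 1 is an algebraically simple eigenvalue of
`S 0`, hence a simple root of its characteristic polynomial. The implicit function theorem continues
this root to an analytic curve of isolated simple eigenvalues. The same nonzero derivative shows
that an eigenpair approximate to O(x³) determines the eigenvalue to O(x³)
(`exists_eigenvalue_curve`), so it is enough to build such a pair.

Since the wavenumber is exactly 1/N, sampling h ↦ (h(t + j/N))_j turns the nonlocal profile equation
into the lattice equation. Differentiating the profile equation in ζ shows that u' solves the
homogeneous equation. Differentiating it in k shows that ∂_k u solves the equation of order x, with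
exponent ν₁ = ω'/ω. The equation of order x² has a periodic solution when its forcing is orthogonal
to the adjoint mode; with ⟨u^ad, ∂_k u⟩ = 0 this gives ν₂ = d/ω (`inner01_second_order_forcing`).
Gronwall's inequality bounds the error of the truncated expansion by O(x³)
(`approximate_floquet_eigenpair`).

The adjoint mode comes from the lattice. Simplicity keeps the eigenvector out of the range of S -
Id, which provides an invariant functional and so a periodic solution W of the adjoint lattice
equation. The superposition ∑_j W_j(t - j/N), the transpose of sampling, solves the adjoint profile
equation (`isAdjointMode_unsample`). -/

/-- Solutions of `V' = A(t) V` are determined by their value at one time. -/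
theorem linearODE_unique {A : ℝ → X →L[ℂ] X} (hA : Continuous A) {V W : ℝ → X}
    (hV : ∀ t, HasDerivAt V (A t (V t)) t) (hW : ∀ t, HasDerivAt W (A t (W t)) t)
    {t₀ : ℝ} (h : V t₀ = W t₀) : V = W := by
  funext t
  obtain ⟨M, hM⟩ := (isCompact_Icc (a := -(|t| + |t₀| + 1))
    (b := |t| + |t₀| + 1)).exists_bound_of_continuousOn hA.continuousOn
  have hlt : ∀ x y : ℝ, x ∈ Ioo (-(|x| + |y| + 1)) (|x| + |y| + 1) := fun x y =>
    ⟨by linarith [neg_abs_le x, abs_nonneg y], by linarith [le_abs_self x, abs_nonneg y]⟩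
  refine ODE_solution_unique_of_mem_Ioo (v := fun t x => A t x) (s := fun _ => univ)
    (K := M.toNNReal) (t₀ := t₀) (a := -(|t| + |t₀| + 1)) (b := |t| + |t₀| + 1) ?_ ?_
    (fun s _ => ⟨hV s, trivial⟩) (fun s _ => ⟨hW s, trivial⟩) h (hlt t t₀)
  · intro s hs
    have hs' := hM s (Ioo_subset_Icc_self hs)
    refine ((A s).lipschitz.weaken ?_).lipschitzOnWith
    rw [← NNReal.coe_le_coe, coe_nnnorm, Real.coe_toNNReal _ ((norm_nonneg _).trans hs')]
    exact hs'
  · have := hlt t₀ t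
    rwa [add_comm |t₀|] at this

variable [CompleteSpace X]

theorem hasDerivAt_evolution_apply {A : ℝ → X →L[ℂ] X} (hA : Continuous A) (x : X) (t s : ℝ) :
    HasDerivAt (fun t => evolution A t s x) (A t (evolution A t s x)) t := by
  exact ((ContinuousLinearMap.apply ℂ X x).restrictScalars ℝ).hasFDerivAt.comp_hasDerivAt t
    (hasDerivAt_evolution hA t s)

theorem eq_evolution_apply {A : ℝ → X →L[ℂ] X} (hA : Continuous A) {V : ℝ → X}
    (hV : ∀ t, HasDerivAt V (A t (V t)) t) (t : ℝ) : V t = evolution A t 0 (V 0) :=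
  congrFun (linearODE_unique hA hV (fun t => hasDerivAt_evolution_apply hA (V 0) t 0)
    (t₀ := 0) (by simp [evolution_self])) t

/-- Linear change of the time variable in an evolution system. -/
theorem evolution_comp_mul {A : ℝ → X →L[ℂ] X} (hA : Continuous A) (c t : ℝ) :
    evolution (fun r => (c : ℂ) • A (c * r)) t 0 = evolution A (c * t) 0 := by
  have hA' : Continuous fun r => (c : ℂ) • A (c * r) := by fun_prop
  ext x
  have h := eq_evolution_apply hA' (V := fun t => evolution A (c * t) 0 x) (fun t => by
    have h1 := (hasDerivAt_evolution_apply hA x (c * t) 0).scomp t ((hasDerivAt_id t).const_mul c)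
    refine h1.congr_deriv ?_
    simp) t
  simp only [mul_zero, evolution_self] at h
  simpa using h.symm

/-- Existence of a solution of the inhomogeneous equation vanishing at time `0`. -/
theorem exists_solution_inhomogeneous {A : ℝ → X →L[ℂ] X} (hA : Continuous A) {H : ℝ → X}
    (hH : Continuous H) :
    ∃ V : ℝ → X, V 0 = 0 ∧ ∀ t, HasDerivAt V (A t (V t) + H t) t := by
  -- The forcing becomes linear after adjoining a scalar coordinate that stays equal to 1: (V, c)' =
  -- (A V + c H, 0).
  let B : ℝ → (X × ℂ) →L[ℂ] (X × ℂ) := fun t =>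
    ContinuousLinearMap.inl ℂ X ℂ ∘L ((A t) ∘L ContinuousLinearMap.fst ℂ X ℂ) +
      ContinuousLinearMap.inl ℂ X ℂ ∘L
        ((ContinuousLinearMap.toSpanSingletonCLE (𝕜 := ℂ) (H t)) ∘L ContinuousLinearMap.snd ℂ X ℂ)
  have hB : Continuous B := by
    dsimp only [B]
    refine Continuous.add ?_ ?_
    · exact continuous_const.clm_comp (hA.clm_comp continuous_const)
    · refine continuous_const.clm_comp (Continuous.clm_comp ?_ continuous_const)
      exact ContinuousLinearMap.toSpanSingletonCLE.continuous.comp hH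
  let Z : ℝ → X × ℂ := fun t => evolution B t 0 (0, 1)
  have hZ : ∀ t, HasDerivAt Z (B t (Z t)) t := fun t => hasDerivAt_evolution_apply hB _ t 0
  have hZ0 : Z 0 = (0, 1) := by simp [Z, evolution_self]
  have hsnd : ∀ t, (Z t).2 = 1 := by
    have hd : ∀ t, HasDerivAt (fun t => (Z t).2) 0 t := fun t => by
      have h := (ContinuousLinearMap.snd ℝ X ℂ).hasFDerivAt.comp_hasDerivAt t (hZ t)
      refine h.congr_deriv ?_
      simp [B]
    intro t
    have := is_const_of_deriv_eq_zero (fun t => (hd t).differentiableAt)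
      (fun t => (hd t).deriv) t 0
    simpa [hZ0] using this
  refine ⟨fun t => (Z t).1, by simp [hZ0], fun t => ?_⟩
  have h := (ContinuousLinearMap.fst ℝ X ℂ).hasFDerivAt.comp_hasDerivAt t (hZ t)
  refine h.congr_deriv ?_
  simp [B, hsnd]

/-- Gronwall: an approximate solution of `V' = A(t) V` is close to the solution. -/
theorem norm_evolution_sub_le {A : ℝ → X →L[ℂ] X} (hA : Continuous A) {P R : ℝ → X} {K ε : ℝ}
    (hK : ∀ t ∈ Icc (0 : ℝ) 1, ‖A t‖ ≤ K) (hP : ∀ t, HasDerivAt P (A t (P t) + R t) t)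
    (hR : ∀ t ∈ Icc (0 : ℝ) 1, ‖R t‖ ≤ ε) :
    ‖evolution A 1 0 (P 0) - P 1‖ ≤ gronwallBound 0 K 1 1 * ε := by
  have hD : ∀ t, HasDerivAt (fun t => evolution A t 0 (P 0) - P t)
      (A t (evolution A t 0 (P 0) - P t) - R t) t := fun t => by
    refine ((hasDerivAt_evolution_apply hA (P 0) t 0).sub (hP t)).congr_deriv ?_
    rw [map_sub]; abel
  have h := norm_le_gronwallBound_of_norm_deriv_right_le (a := 0) (b := 1) (δ := 0) (K := K)
    (ε := ε) (fun t _ => (hD t).continuousAt.continuousWithinAt)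
    (fun t _ => (hD t).hasDerivWithinAt) (by simp [evolution_self])
    (fun t ht => (norm_sub_le _ _).trans (add_le_add
      (((A t).le_opNorm _).trans (mul_le_mul_of_nonneg_right
        (hK t (Ico_subset_Icc_self ht)) (norm_nonneg _))) (hR t (Ico_subset_Icc_self ht))))
    1 (right_mem_Icc.2 zero_le_one)
  -- With zero initial error the Gronwall bound is linear in ε, so ε factors out.
  refine h.trans (le_of_eq ?_)
  unfold gronwallBound
  split_ifs <;> simp; ring

end LinearODE

/-! ### Holomorphic dependence on a parameter -/

section Holomorphic

variable {X : Type*} [NormedAddCommGroup X] [NormedSpace ℂ X]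

/-- Finite sums of `g ξ • Q t` with `g` holomorphic and `Q` continuous. -/
def holoContSpan (E : Type*) [NormedAddCommGroup E] [NormedSpace ℂ E] :
    Submodule ℂ (ℂ → ℝ → E) :=
  Submodule.span ℂ {F | ∃ (g : ℂ → ℂ) (Q : ℝ → E), Differentiable ℂ g ∧ Continuous Q ∧
    F = fun ξ t => g ξ • Q t}

theorem differentiable_of_mem_holoContSpan {E : Type*} [NormedAddCommGroup E] [NormedSpace ℂ E]
    {F : ℂ → ℝ → E} (hF : F ∈ holoContSpan E) (t : ℝ) : Differentiable ℂ fun ξ => F ξ t := by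
  induction hF using Submodule.span_induction with
  | mem F h => obtain ⟨g, Q, hg, -, rfl⟩ := h; exact hg.smul_const _
  | zero => exact differentiable_const 0
  | add F G _ _ hF hG => exact hF.add hG
  | smul c F _ hF => exact hF.const_smul c

theorem continuous_of_mem_holoContSpan {E : Type*} [NormedAddCommGroup E] [NormedSpace ℂ E]
    {F : ℂ → ℝ → E} (hF : F ∈ holoContSpan E) (ξ : ℂ) : Continuous (F ξ) := by
  induction hF using Submodule.span_induction with
  | mem F h => obtain ⟨g, Q, -, hQ, rfl⟩ := h; exact hQ.const_smul _
  | zero => exact continuous_const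
  | add F G _ _ hF hG => exact hF.add hG
  | smul c F _ hF => exact hF.const_smul c

/-- Separating the variables makes the class stable under products and under integration in t. Every
Peano–Baker term therefore stays in it, and its holomorphy needs no differentiation under the
integral sign. -/
theorem mul_mem_holoContSpan {A F : ℂ → ℝ → X →L[ℂ] X} (hA : A ∈ holoContSpan (X →L[ℂ] X))
    (hF : F ∈ holoContSpan (X →L[ℂ] X)) :
    (fun ξ t => A ξ t * F ξ t) ∈ holoContSpan (X →L[ℂ] X) := by
  induction hF using Submodule.span_induction with
  | mem F h =>
    obtain ⟨g, Q, hg, hQ, rfl⟩ := h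
    induction hA using Submodule.span_induction with
    | mem A h =>
      obtain ⟨g', Q', hg', hQ', rfl⟩ := h
      refine Submodule.subset_span ⟨fun ξ => g' ξ * g ξ, fun t => Q' t * Q t, hg'.mul hg,
        hQ'.mul hQ, ?_⟩
      funext ξ t
      rw [smul_mul_smul_comm]
    | zero => convert! Submodule.zero_mem _ using 1
    | add F G _ _ hF hG =>
      convert! Submodule.add_mem _ hF hG using 1
    | smul c F _ hF =>
      convert! Submodule.smul_mem _ c hF using 1
  | zero => convert! Submodule.zero_mem _ using 1; funext ξ t; exact mul_zero _
  | add F G _ _ hF hG =>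
    convert! Submodule.add_mem _ hF hG using 1; funext ξ t; exact mul_add _ _ _
  | smul c F _ hF =>
    convert! Submodule.smul_mem _ c hF using 1; funext ξ t; exact mul_smul_comm c (A ξ t) (F ξ t)

theorem integral_mem_holoContSpan {E : Type*} [NormedAddCommGroup E] [NormedSpace ℂ E]
    {F : ℂ → ℝ → E} (hF : F ∈ holoContSpan E) (s : ℝ) :
    (fun ξ t => ∫ r in s..t, F ξ r) ∈ holoContSpan E := by
  induction hF using Submodule.span_induction with
  | mem F h =>
    obtain ⟨g, Q, hg, hQ, rfl⟩ := h
    refine Submodule.subset_span ⟨g, fun t => ∫ r in s..t, Q r, hg, ?_, ?_⟩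
    · exact intervalIntegral.continuous_primitive (fun a b => hQ.intervalIntegrable a b) s
    · funext ξ t
      exact intervalIntegral.integral_smul _ _
  | zero => convert! Submodule.zero_mem _ using 1; funext ξ t; simp
  | add F G h1 h2 hF hG =>
    convert! Submodule.add_mem _ hF hG using 1
    funext ξ t
    exact intervalIntegral.integral_add
      ((continuous_of_mem_holoContSpan h1 ξ).intervalIntegrable _ _)
      ((continuous_of_mem_holoContSpan h2 ξ).intervalIntegrable _ _)
  | smul c F _ hF =>
    convert! Submodule.smul_mem _ c hF using 1
    funext ξ t
    exact intervalIntegral.integral_smul _ _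

theorem peanoBaker_mem_holoContSpan {A : ℂ → ℝ → X →L[ℂ] X}
    (hA : A ∈ holoContSpan (X →L[ℂ] X)) (s : ℝ) (n : ℕ) :
    (fun ξ => peanoBaker (A ξ) s n) ∈ holoContSpan (X →L[ℂ] X) := by
  induction n with
  | zero =>
    exact Submodule.subset_span ⟨fun _ => 1, fun _ => 1, differentiable_const _, continuous_const,
      by funext ξ t; simp [peanoBaker]⟩
  | succ n ih => exact integral_mem_holoContSpan (mul_mem_holoContSpan hA ih) s

/-- Uniformity in ξ on discs is what the Weierstrass test for the Peano–Baker series requires. -/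
theorem exists_bound_of_mem_holoContSpan {E : Type*} [NormedAddCommGroup E] [NormedSpace ℂ E]
    {F : ℂ → ℝ → E} (hF : F ∈ holoContSpan E) (r R : ℝ) :
    ∃ M, ∀ ξ : ℂ, ‖ξ‖ ≤ r → ∀ t : ℝ, |t| ≤ R → ‖F ξ t‖ ≤ M := by
  induction hF using Submodule.span_induction with
  | mem F h =>
    obtain ⟨g, Q, hg, hQ, rfl⟩ := h
    obtain ⟨M₁, h₁⟩ := (isCompact_closedBall (0 : ℂ) r).exists_bound_of_continuousOn
      hg.continuous.continuousOn
    obtain ⟨M₂, h₂⟩ := (isCompact_Icc (a := -R) (b := R)).exists_bound_of_continuousOn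
      hQ.continuousOn
    refine ⟨M₁ * M₂, fun ξ hξ t ht => ?_⟩
    have h1 := h₁ ξ (by simpa using hξ)
    rw [norm_smul]
    exact mul_le_mul h1 (h₂ t (abs_le.1 ht)) (norm_nonneg _) ((norm_nonneg _).trans h1)
  | zero => exact ⟨0, fun _ _ _ _ => by simp⟩
  | add F G _ _ hF hG =>
    obtain ⟨M₁, h₁⟩ := hF
    obtain ⟨M₂, h₂⟩ := hG
    exact ⟨M₁ + M₂, fun ξ hξ t ht => (norm_add_le _ _).trans (add_le_add (h₁ ξ hξ t ht)
      (h₂ ξ hξ t ht))⟩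
  | smul c F _ hF =>
    obtain ⟨M, h⟩ := hF
    exact ⟨‖c‖ * M, fun ξ hξ t ht => (norm_smul_le c (F ξ t)).trans
      (mul_le_mul_of_nonneg_left (h ξ hξ t ht) (norm_nonneg _))⟩

/-- An evolution system whose generator depends holomorphically on a parameter does so too. -/
theorem differentiable_evolution [CompleteSpace X] {A : ℂ → ℝ → X →L[ℂ] X}
    (hA : A ∈ holoContSpan (X →L[ℂ] X)) (t s : ℝ) :
    Differentiable ℂ fun ξ => evolution (A ξ) t s := by
  intro ξ₀
  set R : ℝ := max |t| |s|
  obtain ⟨M, hM⟩ := exists_bound_of_mem_holoContSpan hA (‖ξ₀‖ + 1) R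
  have hd : DifferentiableOn ℂ (fun ξ => ∑' n, peanoBaker (A ξ) s n t) (Metric.ball ξ₀ 1) := by
    -- The factorial bound on the terms depends on ξ only through the common bound M of the
    -- generators on the unit disc about ξ₀.
    refine Complex.differentiableOn_tsum_of_summable_norm
      (u := fun n => ‖(1 : X →L[ℂ] X)‖ * ((M * |t - s|) ^ n / n.factorial))
      ((Real.summable_pow_div_factorial _).mul_left _) (fun n => ?_) Metric.isOpen_ball
      (fun n ξ hξ => ?_)
    · exact (differentiable_of_mem_holoContSpan
        (peanoBaker_mem_holoContSpan hA s n) t).differentiableOn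
    · have hξ' : ‖ξ‖ ≤ ‖ξ₀‖ + 1 := by
        have h1 : ‖ξ - ξ₀‖ < 1 := by simpa [dist_eq_norm] using hξ
        linarith [norm_le_norm_add_norm_sub' ξ ξ₀]
      exact norm_peanoBaker_le s R M (le_max_right _ _) (fun r hr => hM ξ hξ' r hr) n t
        (le_max_left _ _)
  exact hd.differentiableAt (Metric.ball_mem_nhds ξ₀ one_pos)

end Holomorphic

/-! ### Analytic continuation of a simple eigenvalue -/

section SimpleEigenvalue

variable {X : Type*} [NormedAddCommGroup X] [NormedSpace ℂ X] [FiniteDimensional ℂ X]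

open scoped ContDiff

/-- The characteristic polynomial of `S`, evaluated at `z`. -/
def charEval (S : X →L[ℂ] X) (z : ℂ) : ℂ := (S : X →ₗ[ℂ] X).charpoly.eval z

/-- The matrix of `z - S` in a basis of `X`. -/
def resolventMatrix (S : X →L[ℂ] X) (z : ℂ) :
    Matrix (Fin (Module.finrank ℂ X)) (Fin (Module.finrank ℂ X)) ℂ :=
  LinearMap.toMatrix (Module.finBasis ℂ X) (Module.finBasis ℂ X)
    (algebraMap ℂ (Module.End ℂ X) z - (S : X →ₗ[ℂ] X))

theorem resolventMatrix_apply (S : X →L[ℂ] X) (z : ℂ) (i j : Fin (Module.finrank ℂ X)) :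
    resolventMatrix S z i j = z * (Module.finBasis ℂ X).coord i (Module.finBasis ℂ X j) -
      (Module.finBasis ℂ X).coord i (S (Module.finBasis ℂ X j)) := by
  rw [resolventMatrix, LinearMap.toMatrix_apply, LinearMap.sub_apply,
    Module.algebraMap_end_apply, map_sub, map_smul]
  rfl

theorem charEval_eq_det (S : X →L[ℂ] X) (z : ℂ) : charEval S z = (resolventMatrix S z).det := by
  rw [charEval, LinearMap.eval_charpoly, resolventMatrix, LinearMap.det_toMatrix]

theorem contDiffAt_resolventMatrix_apply {S : ℂ → X →L[ℂ] X} (hS : Differentiable ℂ S)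
    (i j : Fin (Module.finrank ℂ X)) (p : ℂ × ℂ) :
    ContDiffAt ℂ ω (fun q : ℂ × ℂ => resolventMatrix (S q.1) q.2 i j) p := by
  have h1 : ContDiffAt ℂ ω (fun q : ℂ × ℂ => S q.1) p :=
    ContDiffAt.comp p (g := S) (f := Prod.fst) (hS.analyticAt p.1).contDiffAt contDiffAt_fst
  have h2 : ContDiffAt ℂ ω (fun q : ℂ × ℂ => S q.1 (Module.finBasis ℂ X j)) p :=
    h1.clm_apply contDiffAt_const
  have h3 := ((LinearMap.toContinuousLinearMap
    ((Module.finBasis ℂ X).coord i)).contDiff (n := ω)).contDiffAt.comp p h2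
  simp_rw [resolventMatrix_apply]
  exact (contDiffAt_snd.mul contDiffAt_const).sub h3

theorem continuous_adjugate_resolventMatrix {S : ℂ → X →L[ℂ] X} (hS : Differentiable ℂ S)
    (i j : Fin (Module.finrank ℂ X)) :
    Continuous fun q : ℂ × ℂ => (resolventMatrix (S q.1) q.2).adjugate i j := by
  have h : Continuous fun q : ℂ × ℂ => resolventMatrix (S q.1) q.2 :=
    continuous_matrix fun k l => continuous_iff_continuousAt.2 fun p =>
      (contDiffAt_resolventMatrix_apply hS k l p).continuousAt
  exact h.matrix_adjugate.matrix_elem i j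

theorem contDiffAt_charEval {S : ℂ → X →L[ℂ] X} (hS : Differentiable ℂ S) (p : ℂ × ℂ) :
    ContDiffAt ℂ ω (fun q : ℂ × ℂ => charEval (S q.1) q.2) p := by
  simp_rw [charEval_eq_det, Matrix.det_apply]
  refine ContDiffAt.sum fun σ _ => ContDiffAt.const_smul _ (contDiffAt_prod fun i _ => ?_)
  exact contDiffAt_resolventMatrix_apply hS _ _ p

theorem fderiv_charEval {S : ℂ → X →L[ℂ] X} (hS : Differentiable ℂ S) (ξ z : ℂ) :
    fderiv ℂ (fun q : ℂ × ℂ => charEval (S q.1) q.2) (ξ, z) (0, 1) =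
      (S ξ : X →ₗ[ℂ] X).charpoly.derivative.eval z := by
  have h := ((contDiffAt_charEval hS (ξ, z)).differentiableAt (by simp)).hasFDerivAt
  have h2 : HasDerivAt (fun w : ℂ => ((ξ, w) : ℂ × ℂ)) (0, 1) z :=
    (hasDerivAt_const z ξ).prodMk (hasDerivAt_id z)
  exact (h.comp_hasDerivAt z h2).unique ((S ξ : X →ₗ[ℂ] X).charpoly.hasDerivAt z)

theorem spectrum_iff_charEval (S : X →L[ℂ] X) (z : ℂ) : z ∈ spectrum ℂ S ↔ charEval S z = 0 := by
  rw [← AlgEquiv.spectrum_eq (Module.End.toContinuousLinearMap X).symm S,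
    ← Module.End.hasEigenvalue_iff_mem_spectrum, Module.End.hasEigenvalue_iff_isRoot_charpoly]
  rfl

/-- The dimension of the generalized eigenspace is the multiplicity of the root. The right-hand side
is what the implicit function theorem needs, by `fderiv_charEval`, and it is an open condition along
the curve. -/
theorem finrank_maxGenEigenspace_eq_one_iff (S : X →L[ℂ] X) (z : ℂ) :
    Module.finrank ℂ (Module.End.maxGenEigenspace (S : X →ₗ[ℂ] X) z) = 1 ↔
      charEval S z = 0 ∧ (S : X →ₗ[ℂ] X).charpoly.derivative.eval z ≠ 0 := by
  have h0 : (S : X →ₗ[ℂ] X).charpoly ≠ 0 := (LinearMap.charpoly_monic _).ne_zero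
  rw [LinearMap.finrank_maxGenEigenspace_eq]
  have h1 := Polynomial.one_lt_rootMultiplicity_iff_isRoot h0 (t := z)
  have h2 := Polynomial.rootMultiplicity_pos h0 (x := z)
  simp only [Polynomial.IsRoot] at h1 h2
  unfold charEval
  constructor
  · intro h
    have hz := h2.1 (by omega)
    exact ⟨hz, fun hd => by have := h1.2 ⟨hz, hd⟩; omega⟩
  · rintro ⟨h, hd⟩
    have := h2.2 h
    have : ¬ 1 < Polynomial.rootMultiplicity z (S : X →ₗ[ℂ] X).charpoly :=
      fun hlt => hd (h1.1 hlt).2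
    omega

/-- An approximate eigenpair is an approximate zero of the characteristic polynomial. -/
theorem charEval_isBigO {S : ℂ → X →L[ℂ] X} (hS : Differentiable ℂ S) {z : ℂ → ℂ} {P : ℂ → X}
    {z₀ : ℂ} {φ : X} (hφ : φ ≠ 0) (hz : Tendsto z (𝓝 0) (𝓝 z₀)) (hP : Tendsto P (𝓝 0) (𝓝 φ))
    {g : ℂ → ℂ} (hr : (fun ξ => S ξ (P ξ) - z ξ • P ξ) =O[𝓝 0] g) :
    (fun ξ => charEval (S ξ) (z ξ)) =O[𝓝 0] g := by
  set b := Module.finBasis ℂ X with hb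
  -- This coordinate of P ξ stays away from 0 near ξ = 0, so it can be divided out at the end.
  obtain ⟨i, hi⟩ : ∃ i, b.coord i φ ≠ 0 := by
    by_contra! h
    exact hφ (b.ext_elem fun i => by simpa using h i)
  have hcoord : ∀ j, Continuous (b.coord j) := fun j => LinearMap.continuous_of_finiteDimensional _
  have hPi : Tendsto (fun ξ => b.coord i (P ξ)) (𝓝 0) (𝓝 (b.coord i φ)) :=
    ((hcoord i).tendsto φ).comp hP
  have hadj : ∀ j, (fun ξ => (resolventMatrix (S ξ) (z ξ)).adjugate i j) =O[𝓝 0]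
      (fun _ => (1 : ℂ)) := by
    intro j
    have hpair : Tendsto (fun ξ : ℂ => ((ξ, z ξ) : ℂ × ℂ)) (𝓝 0) (𝓝 (0, z₀)) :=
      tendsto_id.prodMk_nhds hz
    exact (((continuous_adjugate_resolventMatrix hS i j).tendsto _).comp hpair).isBigO_one ℂ
  have hres : ∀ j, (fun ξ => b.coord j (z ξ • P ξ - S ξ (P ξ))) =O[𝓝 0] g := by
    intro j
    have h1 := (LinearMap.toContinuousLinearMap (b.coord j)).isBigO_comp
      (fun ξ => z ξ • P ξ - S ξ (P ξ)) (𝓝 0)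
    refine h1.trans ?_
    simpa using hr.neg_left
  -- Cramer's rule: adj(z - S)(z - S)P = det(z - S)P. The residual (z - S)P thus controls the
  -- determinant, the adjugate being bounded.
  have key : ∀ ξ, charEval (S ξ) (z ξ) * b.coord i (P ξ) =
      ∑ j, (resolventMatrix (S ξ) (z ξ)).adjugate i j * b.coord j (z ξ • P ξ - S ξ (P ξ)) := by
    intro ξ
    have h1 : (resolventMatrix (S ξ) (z ξ)).mulVec (b.repr (P ξ)) =
        b.repr (z ξ • P ξ - S ξ (P ξ)) := by
      rw [resolventMatrix, LinearMap.toMatrix_mulVec_repr]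
      rfl
    have h2 : (resolventMatrix (S ξ) (z ξ)).adjugate.mulVec
        ((resolventMatrix (S ξ) (z ξ)).mulVec (b.repr (P ξ))) =
        charEval (S ξ) (z ξ) • ⇑(b.repr (P ξ)) := by
      rw [Matrix.mulVec_mulVec, Matrix.adjugate_mul, Matrix.smul_mulVec, Matrix.one_mulVec,
        charEval_eq_det]
    rw [h1] at h2
    exact (congrFun h2 i).symm
  have hprod : (fun ξ => charEval (S ξ) (z ξ) * b.coord i (P ξ)) =O[𝓝 0] g := by
    simp_rw [key]
    refine Asymptotics.IsBigO.fun_sum fun j _ => ?_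
    simpa using (hadj j).mul (hres j)
  have hinv : (fun ξ => (b.coord i (P ξ))⁻¹) =O[𝓝 0] (fun _ => (1 : ℂ)) :=
    (hPi.inv₀ hi).isBigO_one ℂ
  have h := hprod.mul hinv
  simp only [mul_one] at h
  refine h.congr' ?_ EventuallyEq.rfl
  filter_upwards [hPi.eventually_ne hi] with ξ hξ
  rw [mul_assoc, mul_inv_cancel₀ hξ, mul_one]

/-- Continuation of the algebraically simple eigenvalue `z₀` of `S 0` to an analytic curve of
isolated simple eigenvalues, which approximate eigenpairs approximate to their own order. -/
theorem exists_eigenvalue_curve {S : ℂ → X →L[ℂ] X} (hS : Differentiable ℂ S) {z₀ : ℂ} {φ : X}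
    (hφ : φ ≠ 0)
    (hgen : Module.End.maxGenEigenspace (S 0 : X →ₗ[ℂ] X) z₀ = Submodule.span ℂ {φ}) :
    ∃ ε > 0, ∃ δ > 0, ∃ lam : ℂ → ℂ,
      (∀ ξ : ℂ, ‖ξ‖ < δ → AnalyticAt ℂ lam ξ ∧
        spectrum ℂ (S ξ) ∩ Metric.ball z₀ ε = {lam ξ} ∧
        Module.finrank ℂ (Module.End.maxGenEigenspace (S ξ : X →ₗ[ℂ] X) (lam ξ)) = 1) ∧
      ∀ (z : ℂ → ℂ) (P : ℂ → X) (g : ℂ → ℂ), Tendsto z (𝓝 0) (𝓝 z₀) → Tendsto P (𝓝 0) (𝓝 φ) →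
        (fun ξ => S ξ (P ξ) - z ξ • P ξ) =O[𝓝 0] g → (fun ξ => lam ξ - z ξ) =O[𝓝 0] g := by
  have hone : Module.finrank ℂ (Module.End.maxGenEigenspace (S 0 : X →ₗ[ℂ] X) z₀) = 1 := by
    rw [hgen, finrank_span_singleton hφ]
  obtain ⟨hroot, hder⟩ := (finrank_maxGenEigenspace_eq_one_iff _ _).1 hone
  set G : ℂ × ℂ → ℂ := fun q => charEval (S q.1) q.2 with hG
  have hGc : ContDiffAt ℂ ω G (0, z₀) := contDiffAt_charEval hS _
  have hne : fderiv ℂ G (0, z₀) (0, 1) ≠ 0 := by rw [hG, fderiv_charEval hS]; exact hder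
  have hinv : (fderiv ℂ G (0, z₀) ∘L .inr ℂ ℂ ℂ).IsInvertible := by
    refine ⟨ContinuousLinearEquiv.unitsEquivAut ℂ (Units.mk0 _ hne), ?_⟩
    ext
    simp
  have hG0 : G (0, z₀) = 0 := hroot
  set lam := hGc.implicitFunction (by simp) hinv with hlam
  have hlam0 : lam 0 = z₀ := hGc.implicitFunction_apply_self (by simp) hinv
  have hlamA : AnalyticAt ℂ lam 0 :=
    ContDiffAt.analyticAt (hGc.contDiffAt_implicitFunction (by simp) hinv)
  have hlamc : Tendsto lam (𝓝 0) (𝓝 z₀) := hlam0 ▸ hlamA.continuousAt.tendsto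
  have hzero : ∀ᶠ ξ in 𝓝 (0 : ℂ), G (ξ, lam ξ) = 0 := by
    have := hGc.eventually_apply_implicitFunction (by simp) hinv
    rwa [hG0] at this
  have hiff : ∀ᶠ q in 𝓝 ((0 : ℂ), z₀), G q = 0 ↔ lam q.1 = q.2 := by
    have := hGc.eventually_apply_eq_iff_implicitFunction (by simp) hinv
    rwa [hG0] at this
  have hdne : ∀ᶠ q in 𝓝 ((0 : ℂ), z₀), fderiv ℂ G q (0, 1) ≠ 0 := by
    have hc : ContinuousAt (fderiv ℂ G) (0, z₀) :=
      (hGc.fderiv_right (m := 0) (by simp)).continuousAt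
    exact (hc.clm_apply continuousAt_const).eventually_ne hne
  -- The product carries the sup distance, so this ball is a bidisc: its radius serves both for ξ
  -- and for the isolation of the eigenvalue in z.
  obtain ⟨ε, hε, hball⟩ := Metric.eventually_nhds_iff.1 (hiff.and hdne)
  have hmem : ∀ᶠ ξ in 𝓝 (0 : ℂ), dist (lam ξ) z₀ < ε := hlamc (Metric.ball_mem_nhds _ hε)
  obtain ⟨δ, hδ, hsmall⟩ := Metric.eventually_nhds_iff.1
    ((hzero.and hmem).and hlamA.eventually_analyticAt)
  refine ⟨ε, hε, min δ ε, lt_min hδ hε, lam, fun ξ hξ => ?_, ?_⟩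
  · have hξδ : dist ξ 0 < δ := by simpa using hξ.trans_le (min_le_left _ _)
    have hξε : dist ξ 0 < ε := by simpa using hξ.trans_le (min_le_right _ _)
    obtain ⟨⟨h0, hm⟩, hA⟩ := hsmall hξδ
    refine ⟨hA, ?_, ?_⟩
    · ext z
      simp only [mem_inter_iff, spectrum_iff_charEval, Metric.mem_ball, mem_singleton_iff]
      constructor
      · rintro ⟨hz, hd⟩
        have := hball (y := (ξ, z)) (by rw [Prod.dist_eq]; exact max_lt hξε hd)
        exact (this.1.1 hz).symm
      · rintro rfl
        exact ⟨h0, hm⟩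
    · rw [finrank_maxGenEigenspace_eq_one_iff]
      refine ⟨h0, ?_⟩
      have := (hball (y := (ξ, lam ξ)) (by rw [Prod.dist_eq]; exact max_lt hξε hm)).2
      rwa [hG, fderiv_charEval hS] at this
  · intro z P g hz hP hr
    have hO := charEval_isBigO hS hφ hz hP hr
    have hstrict := (hGc.hasStrictFDerivAt (by simp)).isLittleO
    have htend : Tendsto (fun ξ : ℂ => (((ξ, lam ξ) : ℂ × ℂ), ((ξ, z ξ) : ℂ × ℂ))) (𝓝 0)
        (𝓝 ((0, z₀), (0, z₀))) :=
      (tendsto_id.prodMk_nhds hlamc).prodMk_nhds (tendsto_id.prodMk_nhds hz)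
    have h1 := hstrict.comp_tendsto htend
    -- Strict differentiability allows both points to move: G(ξ, lam) - G(ξ, z) = ∂_z G · (lam - z)
    -- + o(lam - z). The left side is -G(ξ, z) = O(g), and ∂_z G ≠ 0 transfers this bound to lam -
    -- z.
    have h2 : (fun ξ => G (ξ, lam ξ) - G (ξ, z ξ) - fderiv ℂ G (0, z₀) (0, 1) * (lam ξ - z ξ))
        =o[𝓝 0] fun ξ => lam ξ - z ξ := by
      refine (h1.congr (fun ξ => ?_) (fun ξ => rfl)).trans_isBigO ?_
      · have : ((ξ, lam ξ) : ℂ × ℂ) - (ξ, z ξ) = (lam ξ - z ξ) • (0, 1) := by simp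
        simp only [Function.comp]
        rw [this, map_smul, smul_eq_mul, mul_comm]
      · refine Asymptotics.IsBigO.of_bound 1 (Eventually.of_forall fun ξ => ?_)
        simp [Prod.norm_def]
    have h3 : (fun ξ => lam ξ - z ξ) =O[𝓝 0]
        fun ξ => fderiv ℂ G (0, z₀) (0, 1) * (lam ξ - z ξ) :=
      Asymptotics.isBigO_self_const_mul hne _ _
    have h4 := (h2.trans_isBigO h3).right_isBigO_add
    refine h3.trans (h4.trans ?_)
    have h5 : (fun ξ => G (ξ, lam ξ) - G (ξ, z ξ)) =O[𝓝 0] g := by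
      refine (hO.neg_left).congr' ?_ EventuallyEq.rfl
      filter_upwards [hzero] with ξ hξ
      rw [hξ, zero_sub]
    exact h5.congr_left fun ξ => by ring

end SimpleEigenvalue

/-! ### Fredholm alternative at a simple eigenvalue -/

section Fredholm

variable {X : Type*} [AddCommGroup X] [Module ℂ X] {S : X →ₗ[ℂ] X} {φ : X}

/-- An algebraically simple eigenvector is not in the range of `S - Id`. -/
theorem sub_self_ne_of_simple (hφ : φ ≠ 0) (hSφ : S φ = φ)
    (hgen : Module.End.maxGenEigenspace S 1 = Submodule.span ℂ {φ}) (x : X) : S x - x ≠ φ := by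
  intro hx
  have hmem : x ∈ Module.End.maxGenEigenspace S 1 := by
    rw [Module.End.mem_maxGenEigenspace]
    -- If (S - 1)x = φ, then (S - 1)²x = 0, so x would lie in the span of φ, which S - 1 kills.
    refine ⟨2, ?_⟩
    have : ∀ y, (S - (1 : ℂ) • (1 : Module.End ℂ X)) y = S y - y := fun y => by simp
    rw [pow_two, Module.End.mul_apply, this, this, hx, hSφ, sub_self]
  rw [hgen, Submodule.mem_span_singleton] at hmem
  obtain ⟨c, rfl⟩ := hmem
  rw [map_smul, hSφ, sub_self] at hx
  exact hφ hx.symm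

/-- At an algebraically simple eigenvalue, the eigenvector spans a complement of the range. -/
theorem exists_eq_sub_self_add_smul [FiniteDimensional ℂ X] (hφ : φ ≠ 0) (hSφ : S φ = φ)
    (hgen : Module.End.maxGenEigenspace S 1 = Submodule.span ℂ {φ}) (y : X) :
    ∃ (x : X) (c : ℂ), y = S x - x + c • φ := by
  set T : X →ₗ[ℂ] X := S - LinearMap.id with hT
  have hker : LinearMap.ker T ≤ Submodule.span ℂ {φ} := by
    intro x hx
    rw [← hgen, Module.End.mem_maxGenEigenspace]
    refine ⟨1, ?_⟩
    simpa [hT] using hx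
  have hdisj : LinearMap.range T ⊓ Submodule.span ℂ {φ} = ⊥ := by
    rw [eq_bot_iff]
    rintro z ⟨⟨x, rfl⟩, hz⟩
    obtain ⟨c, hc⟩ := Submodule.mem_span_singleton.1 hz
    rcases eq_or_ne c 0 with rfl | hc0
    · simp [← hc]
    · refine absurd ?_ (sub_self_ne_of_simple hφ hSφ hgen (c⁻¹ • x))
      have hx : S x - x = c • φ := hc.symm
      rw [map_smul, ← smul_sub, hx, inv_smul_smul₀ hc0]
  have h1 := LinearMap.finrank_range_add_finrank_ker T
  have h2 := Submodule.finrank_sup_add_finrank_inf_eq (LinearMap.range T) (Submodule.span ℂ {φ})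
  have h3 := Submodule.finrank_mono hker
  have h4 : Module.finrank ℂ (⊥ : Submodule ℂ X) = 0 := finrank_bot ℂ X
  have h5 : Module.finrank ℂ (Submodule.span ℂ {φ}) = 1 := finrank_span_singleton hφ
  rw [hdisj] at h2
  -- Dimension count: the kernel has dimension at most 1, so the range has codimension at most 1,
  -- and it meets the line of φ trivially.
  have htop : LinearMap.range T ⊔ Submodule.span ℂ {φ} = ⊤ := by
    refine Submodule.eq_top_of_finrank_eq (le_antisymm (Submodule.finrank_le _) ?_)
    omega
  have hy : y ∈ LinearMap.range T ⊔ Submodule.span ℂ {φ} := htop ▸ Submodule.mem_top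
  obtain ⟨_, ⟨x, rfl⟩, z, hz, rfl⟩ := Submodule.mem_sup.1 hy
  obtain ⟨c, rfl⟩ := Submodule.mem_span_singleton.1 hz
  exact ⟨x, c, rfl⟩

end Fredholm

/-! ### Second order expansion of a Floquet multiplier -/

section Expansion

variable {X : Type*} [NormedAddCommGroup X] [NormedSpace ℂ X] [CompleteSpace X]

/-- Subtracting the homogeneous solution that starts at y moves the time-one mismatch V(1) into the
range of S - Id. -/
theorem exists_periodic_solution_inhomogeneous {A : ℝ → X →L[ℂ] X} (hA : Continuous A)
    {H V : ℝ → X} (hV0 : V 0 = 0) (hV : ∀ t, HasDerivAt V (A t (V t) + H t) t)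
    {y : X} (hy : evolution A 1 0 y - y = V 1) :
    ∃ Z : ℝ → X, Z 1 = Z 0 ∧ ∀ t, HasDerivAt Z (A t (Z t) + H t) t := by
  refine ⟨fun t => V t - evolution A t 0 y, ?_, fun t => ?_⟩
  · simp [hV0, evolution_self, ← hy]
  · refine ((hV t).sub (hasDerivAt_evolution_apply hA y t 0)).congr_deriv ?_
    rw [map_sub]; abel

/-- The formal second order expansion of a Floquet eigenpair of `V' = (A(t) + C(x)) V` in powers
of `x` is an approximate eigenpair up to `O(x³)`. -/
theorem approximate_floquet_eigenpair {A : ℝ → X →L[ℂ] X} (hA : Continuous A) {C : ℂ → X →L[ℂ] X}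
    {B₁ B₂ : X →L[ℂ] X} {K : ℝ}
    (hC : ∀ x : ℂ, ‖x‖ ≤ 1 → ‖C x - x • B₁ - x ^ 2 • B₂‖ ≤ K * ‖x‖ ^ 3)
    {φ V₁ V₂ : ℝ → X} {ν₁ ν₂ : ℂ} (hφ : ∀ t, HasDerivAt φ (A t (φ t)) t)
    (hV₁ : ∀ t, HasDerivAt V₁ (A t (V₁ t) + (B₁ (φ t) - ν₁ • φ t)) t)
    (hV₂ : ∀ t, HasDerivAt V₂
      (A t (V₂ t) + (B₁ (V₁ t) + B₂ (φ t) - ν₂ • φ t - ν₁ • V₁ t)) t)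
    (hφp : φ 1 = φ 0) (hV₁p : V₁ 1 = V₁ 0) (hV₂p : V₂ 1 = V₂ 0) :
    (fun x : ℂ => evolution (fun t => A t + C x) 1 0 (φ 0 + x • V₁ 0 + x ^ 2 • V₂ 0) -
      Complex.exp (ν₁ * x + ν₂ * x ^ 2) • (φ 0 + x • V₁ 0 + x ^ 2 • V₂ 0))
      =O[𝓝 0] fun x => x ^ 3 := by
  have hbd : ∀ F : ℝ → X, (∀ t, ∃ F', HasDerivAt F F' t) → ∃ M, ∀ t ∈ Icc (0 : ℝ) 1, ‖F t‖ ≤ M :=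
    fun F hF => isCompact_Icc.exists_bound_of_continuousOn
      fun t _ => (hF t).choose_spec.continuousAt.continuousWithinAt
  obtain ⟨Mφ, hMφ⟩ := hbd φ fun t => ⟨_, hφ t⟩
  obtain ⟨M₁, hM₁⟩ := hbd V₁ fun t => ⟨_, hV₁ t⟩
  obtain ⟨M₂, hM₂⟩ := hbd V₂ fun t => ⟨_, hV₂ t⟩
  obtain ⟨MA, hMA⟩ := (isCompact_Icc (a := (0 : ℝ)) (b := 1)).exists_bound_of_continuousOn
    hA.continuousOn
  have hK : 0 ≤ K := by simpa using (norm_nonneg _).trans (hC 1 (by simp))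
  set e : ℝ := Real.exp (‖ν₁‖ + ‖ν₂‖)
  set c : ℝ := K * (Mφ + M₁ + M₂) +
    (‖ν₁‖ * M₂ + ‖ν₂‖ * M₁ + ‖B₁‖ * M₂ + ‖B₂‖ * M₁) + (‖ν₂‖ * M₂ + ‖B₂‖ * M₂) with hc
  refine Asymptotics.IsBigO.of_bound
    (gronwallBound 0 (MA + (K + ‖B₁‖ + ‖B₂‖)) 1 1 * (e * c)) ?_
  filter_upwards [Metric.closedBall_mem_nhds (0 : ℂ) one_pos] with x hx
  replace hx : ‖x‖ ≤ 1 := by simpa using hx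
  have hx2 : ‖x‖ ^ 2 ≤ 1 := pow_le_one₀ (norm_nonneg _) hx
  have hx3 : ‖x‖ ^ 3 ≤ 1 := pow_le_one₀ (norm_nonneg _) hx
  set ν : ℂ := ν₁ * x + ν₂ * x ^ 2 with hν
  set D : X →L[ℂ] X := C x - x • B₁ - x ^ 2 • B₂ with hD
  have hCx : C x = D + x • B₁ + x ^ 2 • B₂ := by rw [hD]; abel
  set Q : ℝ → X := fun t => φ t + x • V₁ t + x ^ 2 • V₂ t with hQ
  -- The defect of e^{νt}Q(t), up to the factor e^{νt}. Orders 1, x and x² cancel by the equations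
  -- for φ, V₁ and V₂; what survives has order x³ and x⁴, together with the Taylor remainder D of C.
  set E : ℝ → X := fun t => x ^ 3 • (ν₁ • V₂ t + ν₂ • V₁ t - B₁ (V₂ t) - B₂ (V₁ t)) +
    x ^ 4 • (ν₂ • V₂ t - B₂ (V₂ t)) - D (Q t) with hE
  have hexp : ∀ t : ℝ, HasDerivAt (fun t : ℝ => Complex.exp (ν * t)) (Complex.exp (ν * t) * ν) t :=
    fun t => by
      have h := ((hasDerivAt_id (t : ℂ)).const_mul ν).cexp.comp_ofReal
      simpa using h
  have hP : ∀ t, HasDerivAt (fun t : ℝ => Complex.exp (ν * t) • Q t)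
      ((A t + C x) (Complex.exp (ν * t) • Q t) + Complex.exp (ν * t) • E t) t := by
    intro t
    have hQ' : HasDerivAt Q _ t :=
      ((hφ t).add ((hV₁ t).const_smul x)).add ((hV₂ t).const_smul (x ^ 2))
    refine ((hexp t).smul hQ').congr_deriv ?_
    simp only [hE, hQ, hCx, hν, add_apply, smul_apply,
      map_add, map_smul]
    module
  have hA' : Continuous fun t => A t + C x := by fun_prop
  have hDn : ‖D‖ ≤ K * ‖x‖ ^ 3 := hC x hx
  have hCn : ‖C x‖ ≤ K + ‖B₁‖ + ‖B₂‖ := by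
    rw [hCx]
    refine (norm_add₃_le).trans ?_
    rw [norm_smul, norm_smul, norm_pow]
    have h1 : K * ‖x‖ ^ 3 ≤ K := mul_le_of_le_one_right hK hx3
    have h2 : ‖x‖ * ‖B₁‖ ≤ ‖B₁‖ := mul_le_of_le_one_left (norm_nonneg _) hx
    have h3 : ‖x‖ ^ 2 * ‖B₂‖ ≤ ‖B₂‖ := mul_le_of_le_one_left (norm_nonneg _) hx2
    linarith
  have hEn : ∀ t ∈ Icc (0 : ℝ) 1, ‖Complex.exp (ν * t) • E t‖ ≤ e * c * ‖x‖ ^ 3 := by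
    intro t ht
    have h0 := hMφ t ht
    have h1 := hM₁ t ht
    have h2 := hM₂ t ht
    have hen : ‖Complex.exp (ν * t)‖ ≤ e := by
      rw [Complex.norm_exp]
      refine Real.exp_le_exp.2 ((Complex.re_le_norm _).trans ?_)
      rw [norm_mul, Complex.norm_real, Real.norm_of_nonneg ht.1]
      refine (mul_le_of_le_one_right (norm_nonneg _) ht.2).trans ((norm_add_le _ _).trans ?_)
      rw [norm_mul, norm_mul, norm_pow]
      exact add_le_add (mul_le_of_le_one_right (norm_nonneg _) hx)
        (mul_le_of_le_one_right (norm_nonneg _) hx2)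
    have hQn : ‖Q t‖ ≤ Mφ + M₁ + M₂ := by
      refine (norm_add₃_le).trans ?_
      rw [norm_smul, norm_smul, norm_pow]
      have h3 : ‖x‖ * ‖V₁ t‖ ≤ ‖V₁ t‖ := mul_le_of_le_one_left (norm_nonneg _) hx
      have h4 : ‖x‖ ^ 2 * ‖V₂ t‖ ≤ ‖V₂ t‖ := mul_le_of_le_one_left (norm_nonneg _) hx2
      linarith
    have hDQ : ‖D (Q t)‖ ≤ ‖x‖ ^ 3 * (K * (Mφ + M₁ + M₂)) := by
      refine (D.le_opNorm _).trans ?_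
      refine (mul_le_mul hDn hQn (norm_nonneg _) (by positivity)).trans (le_of_eq (by ring))
    have hop : ∀ (B : X →L[ℂ] X) (v : X) (m : ℝ), ‖v‖ ≤ m → ‖B v‖ ≤ ‖B‖ * m := fun B v m h =>
      (B.le_opNorm v).trans (mul_le_mul_of_nonneg_left h (norm_nonneg _))
    have hsm : ∀ (b : ℂ) (v : X) (m : ℝ), ‖v‖ ≤ m → ‖b • v‖ ≤ ‖b‖ * m := fun b v m h =>
      (norm_smul_le b v).trans (mul_le_mul_of_nonneg_left h (norm_nonneg _))
    have hT3 : ‖x ^ 3 • (ν₁ • V₂ t + ν₂ • V₁ t - B₁ (V₂ t) - B₂ (V₁ t))‖ ≤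
        ‖x‖ ^ 3 * (‖ν₁‖ * M₂ + ‖ν₂‖ * M₁ + ‖B₁‖ * M₂ + ‖B₂‖ * M₁) := by
      rw [← norm_pow]
      refine hsm _ _ _ ?_
      refine (norm_sub_le _ _).trans (add_le_add ((norm_sub_le _ _).trans
        (add_le_add ((norm_add_le _ _).trans (add_le_add ?_ ?_)) ?_)) ?_)
      exacts [hsm _ _ _ h2, hsm _ _ _ h1, hop _ _ _ h2, hop _ _ _ h1]
    have hT4 : ‖x ^ 4 • (ν₂ • V₂ t - B₂ (V₂ t))‖ ≤ ‖x‖ ^ 3 * (‖ν₂‖ * M₂ + ‖B₂‖ * M₂) := by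
      have h5 : ‖ν₂ • V₂ t - B₂ (V₂ t)‖ ≤ ‖ν₂‖ * M₂ + ‖B₂‖ * M₂ :=
        (norm_sub_le _ _).trans (add_le_add (hsm _ _ _ h2) (hop _ _ _ h2))
      rw [norm_smul, norm_pow]
      exact mul_le_mul (pow_le_pow_of_le_one (norm_nonneg _) hx (by norm_num)) h5 (norm_nonneg _)
        (by positivity)
    have hE' : ‖E t‖ ≤ c * ‖x‖ ^ 3 := by
      refine (norm_sub_le _ _).trans ((add_le_add ((norm_add_le _ _).trans
        (add_le_add hT3 hT4)) hDQ).trans (le_of_eq ?_))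
      rw [hc]; ring
    rw [norm_smul, mul_assoc]
    exact mul_le_mul hen hE' (norm_nonneg _) (Real.exp_pos _).le
  have h := norm_evolution_sub_le hA' (K := MA + (K + ‖B₁‖ + ‖B₂‖))
    (fun t ht => (norm_add_le _ _).trans (add_le_add (hMA t ht) hCn)) hP hEn
  -- By periodicity the approximate solution takes exactly the value e^ν Q(0) at time one, so its
  -- distance to the true solution is the eigenpair residual.
  have hQ1 : Q 1 = Q 0 := by simp only [hQ, hφp, hV₁p, hV₂p]
  simp only [Complex.ofReal_zero, mul_zero, Complex.exp_zero, one_smul, Complex.ofReal_one,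
    mul_one, hQ1] at h
  rw [norm_pow, mul_assoc]
  exact h

end Expansion

/-! ### Lattice operators on `N`-periodic sequences -/

section LatticeOperators

variable {d : ℕ} (N : ℕ) [NeZero N]

/-- The shift `V ↦ V (· + m)` of `N`-periodic sequences. -/
def shift (m : ZMod N) : (ZMod N → Fin d → ℂ) →L[ℂ] (ZMod N → Fin d → ℂ) :=
  LinearMap.toContinuousLinearMap (LinearMap.funLeft ℂ (Fin d → ℂ) fun j => j + m)

@[simp] theorem shift_apply (m : ZMod N) (V : ZMod N → Fin d → ℂ) (j : ZMod N) :
    shift N m V j = V (j + m) := rfl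

/-- Multiplication of sequences by the samples of a matrix-valued function. -/
def potential (J : ℝ → Matrix (Fin d) (Fin d) ℂ) (t : ℝ) :
    (ZMod N → Fin d → ℂ) →L[ℂ] (ZMod N → Fin d → ℂ) :=
  LinearMap.toContinuousLinearMap
    (LinearMap.pi fun j => (J (t + j.val / N)).mulVecLin ∘ₗ LinearMap.proj j)

@[simp] theorem potential_apply (J : ℝ → Matrix (Fin d) (Fin d) ℂ) (t : ℝ)
    (V : ZMod N → Fin d → ℂ) (j : ZMod N) :
    potential N J t V j = (J (t + j.val / N)).mulVec (V j) := rfl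

/-- The generator `V ↦ c₁ (V_{j+1} - 2 V_j + V_{j-1}) + c₂ J V_j`. -/
def waveOp (c₁ c₂ : ℝ) (J : ℝ → Matrix (Fin d) (Fin d) ℂ) (t : ℝ) :
    (ZMod N → Fin d → ℂ) →L[ℂ] (ZMod N → Fin d → ℂ) :=
  (c₁ : ℂ) • (shift N 1 - (2 : ℂ) • 1 + shift N (-1)) + (c₂ : ℂ) • potential N J t

/-- The perturbation `c ((e^x - 1) V_{j+1} + (e^{-x} - 1) V_{j-1})` of the generator at the
Floquet exponent `-i x`. -/
def blochPerturbation (d : ℕ) (c : ℝ) (x : ℂ) : (ZMod N → Fin d → ℂ) →L[ℂ] (ZMod N → Fin d → ℂ) :=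
  ((c : ℂ) * (Complex.exp x - 1)) • shift N 1 + ((c : ℂ) * (Complex.exp (-x) - 1)) • shift N (-1)

theorem blochPerturbation_zero (d : ℕ) (c : ℝ) : blochPerturbation N d c 0 = 0 := by
  simp only [blochPerturbation, neg_zero, Complex.exp_zero, sub_self, mul_zero]
  module

theorem waveOp_apply (c₁ c₂ : ℝ) (J : ℝ → Matrix (Fin d) (Fin d) ℂ) (t : ℝ)
    (V : ZMod N → Fin d → ℂ) (j : ZMod N) :
    waveOp N c₁ c₂ J t V j = (c₁ : ℂ) • (V (j + 1) - (2 : ℂ) • V j + V (j - 1)) +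
      (c₂ : ℂ) • (J (t + j.val / N)).mulVec (V j) := by
  simp [waveOp, sub_eq_add_neg]

theorem continuous_potential {J : ℝ → Matrix (Fin d) (Fin d) ℂ} (hJ : Continuous J) :
    Continuous (potential N J) := by
  refine continuous_clm_apply.2 fun V => continuous_pi fun j => ?_
  simp only [potential_apply]
  exact (hJ.comp (by fun_prop)).matrix_mulVec continuous_const

theorem continuous_waveOp (c₁ c₂ : ℝ) {J : ℝ → Matrix (Fin d) (Fin d) ℂ} (hJ : Continuous J) :
    Continuous (waveOp N c₁ c₂ J) :=
  Continuous.add continuous_const (Continuous.fun_const_smul (continuous_potential N hJ) _)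

theorem waveOp_periodic (c₁ c₂ : ℝ) {J : ℝ → Matrix (Fin d) (Fin d) ℂ}
    (hJ : Function.Periodic J 1) : Function.Periodic (waveOp N c₁ c₂ J) 1 := by
  intro t
  ext V j : 2
  rw [waveOp_apply, waveOp_apply, add_right_comm, hJ]

theorem waveOp_add_blochPerturbation_mem_holoContSpan (c₁ c₂ : ℝ)
    {J : ℝ → Matrix (Fin d) (Fin d) ℂ} (hJ : Continuous J) :
    (fun x t => waveOp N c₁ c₂ J t + blochPerturbation N d c₁ x) ∈
      holoContSpan ((ZMod N → Fin d → ℂ) →L[ℂ] (ZMod N → Fin d → ℂ)) := by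
  have h1 : (fun (_ : ℂ) t => (1 : ℂ) • waveOp N c₁ c₂ J t) ∈
      holoContSpan ((ZMod N → Fin d → ℂ) →L[ℂ] (ZMod N → Fin d → ℂ)) :=
    Submodule.subset_span ⟨_, _, differentiable_const _, continuous_waveOp N c₁ c₂ hJ, rfl⟩
  have h2 : (fun (x : ℂ) (_ : ℝ) => ((c₁ : ℂ) * (Complex.exp x - 1)) • shift (d := d) N 1) ∈
      holoContSpan ((ZMod N → Fin d → ℂ) →L[ℂ] (ZMod N → Fin d → ℂ)) :=
    Submodule.subset_span ⟨_, fun _ => shift N 1, by fun_prop, continuous_const, rfl⟩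
  have h3 : (fun (x : ℂ) (_ : ℝ) => ((c₁ : ℂ) * (Complex.exp (-x) - 1)) • shift (d := d) N (-1)) ∈
      holoContSpan ((ZMod N → Fin d → ℂ) →L[ℂ] (ZMod N → Fin d → ℂ)) :=
    Submodule.subset_span ⟨_, fun _ => shift N (-1), by fun_prop, continuous_const, rfl⟩
  convert! Submodule.add_mem _ h1 (Submodule.add_mem _ h2 h3) using 1
  funext x t
  simp [blochPerturbation]

theorem norm_exp_sub_quadratic_le {x : ℂ} (hx : ‖x‖ ≤ 1) :
    ‖Complex.exp x - 1 - x - x ^ 2 / 2‖ ≤ ‖x‖ ^ 3 := by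
  have h := Complex.exp_bound hx (n := 3) (by norm_num)
  have hs : ∑ m ∈ Finset.range 3, x ^ m / (m.factorial : ℂ) = 1 + x + x ^ 2 / 2 := by
    simp [Finset.sum_range_succ, Nat.factorial]
  rw [hs] at h
  have he : Complex.exp x - 1 - x - x ^ 2 / 2 = Complex.exp x - (1 + x + x ^ 2 / 2) := by ring
  rw [he]
  -- The exponential bound with three terms carries the factor 4/(3!·3) ≤ 1.
  refine h.trans (mul_le_of_le_one_right (by positivity) ?_)
  norm_num [Nat.factorial]

/-- Second order Taylor expansion of the Bloch perturbation. -/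
theorem norm_blochPerturbation_sub_le (c : ℝ) {x : ℂ} (hx : ‖x‖ ≤ 1) :
    ‖blochPerturbation N d c x - x • ((c : ℂ) • (shift N 1 - shift N (-1))) -
      x ^ 2 • (((c : ℂ) / 2) • (shift N 1 + shift N (-1)))‖ ≤
      (|c| * (‖shift (d := d) N 1‖ + ‖shift (d := d) N (-1)‖)) * ‖x‖ ^ 3 := by
  have h1 := norm_exp_sub_quadratic_le hx
  have h2 := norm_exp_sub_quadratic_le (x := -x) (by simpa using hx)
  have he : blochPerturbation N d c x - x • ((c : ℂ) • (shift N 1 - shift N (-1))) -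
      x ^ 2 • (((c : ℂ) / 2) • (shift N 1 + shift N (-1))) =
      ((c : ℂ) * (Complex.exp x - 1 - x - x ^ 2 / 2)) • shift N 1 +
      ((c : ℂ) * (Complex.exp (-x) - 1 - (-x) - (-x) ^ 2 / 2)) • shift N (-1) := by
    unfold blochPerturbation
    module
  rw [he]
  refine (norm_add_le _ _).trans ?_
  rw [norm_smul, norm_smul, norm_mul, norm_mul, Complex.norm_real, Real.norm_eq_abs]
  rw [norm_neg] at h2
  have h3 : |c| * ‖Complex.exp x - 1 - x - x ^ 2 / 2‖ * ‖shift (d := d) N 1‖ ≤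
      |c| * ‖x‖ ^ 3 * ‖shift (d := d) N 1‖ := by gcongr
  have h4 : |c| * ‖Complex.exp (-x) - 1 - (-x) - (-x) ^ 2 / 2‖ * ‖shift (d := d) N (-1)‖ ≤
      |c| * ‖x‖ ^ 3 * ‖shift (d := d) N (-1)‖ := by gcongr
  linarith

/-- The Floquet operator is the time-one map of the evolution in the phase variable. -/
theorem floquet_eq_evolution (μ : ℝ) (f : (Fin d → ℝ) → Fin d → ℝ) (u : ℝ → Fin d → ℝ) {ω : ℝ}
    (hω : ω ≠ 0) (hJ : Continuous fun ζ => jac f (u ζ)) (ξ : ℝ) :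
    floquet N μ f u ω ξ =
      evolution (fun t => waveOp N (μ / ω) (1 / ω) (fun ζ => jac f (u ζ)) t +
        blochPerturbation N d (μ / ω) (Complex.I * ξ)) 1 0 := by
  set A : ℝ → (ZMod N → Fin d → ℂ) →L[ℂ] (ZMod N → Fin d → ℂ) := fun t =>
    waveOp N μ 1 (fun ζ => jac f (u ζ)) (ω * t) + blochPerturbation N d μ (Complex.I * ξ) with hA
  have hAc : Continuous A :=
    ((continuous_waveOp N μ 1 hJ).comp (by fun_prop)).add continuous_const
  have hbloch : ∀ t, blochSymbol N ξ (linearization μ f u (1 / N) ω t) = A t := by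
    intro t
    ext V j : 2
    -- The exponentials are read at the integers j.val ± 1 without reduction mod N, while V is read
    -- mod N. The quotients are therefore e^{±iξ} even where the index wraps around.
    have hc1 : (((j.val : ℤ) + 1 : ℤ) : ZMod N) = j + 1 := by simp
    have hc2 : (((j.val : ℤ) - 1 : ℤ) : ZMod N) = j - 1 := by simp
    have hc0 : (((j.val : ℤ) : ℤ) : ZMod N) = j := by simp
    have he1 : Complex.exp (-(Complex.I * (j.val : ℂ) * ξ)) *
        Complex.exp (Complex.I * ((j.val : ℂ) + 1) * ξ) = Complex.exp (Complex.I * ξ) := by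
      rw [← Complex.exp_add]; ring_nf
    have he2 : Complex.exp (-(Complex.I * (j.val : ℂ) * ξ)) *
        Complex.exp (Complex.I * ((j.val : ℂ) - 1) * ξ) = Complex.exp (-(Complex.I * ξ)) := by
      rw [← Complex.exp_add]; ring_nf
    have he0 : Complex.exp (-(Complex.I * (j.val : ℂ) * ξ)) *
        Complex.exp (Complex.I * (j.val : ℂ) * ξ) = 1 := by
      rw [← Complex.exp_add]; simp
    have hL : blochSymbol N ξ (linearization μ f u (1 / N) ω t) V j =
        Complex.exp (-(Complex.I * (j.val : ℂ) * ξ)) •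
        ((μ : ℂ) • (Complex.exp (Complex.I * (((j.val : ℤ) + 1 : ℤ) : ℂ) * ξ) •
            V (((j.val : ℤ) + 1 : ℤ) : ZMod N) -
          (2 : ℂ) • (Complex.exp (Complex.I * ((j.val : ℤ) : ℂ) * ξ) •
            V (((j.val : ℤ) : ℤ) : ZMod N)) +
          Complex.exp (Complex.I * (((j.val : ℤ) - 1 : ℤ) : ℂ) * ξ) •
            V (((j.val : ℤ) - 1 : ℤ) : ZMod N)) +
        (jac f (u (1 / N * ((j.val : ℤ) : ℝ) + ω * t))).mulVec
          (Complex.exp (Complex.I * ((j.val : ℤ) : ℂ) * ξ) • V (((j.val : ℤ) : ℤ) : ZMod N))) := rfl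
    have harg : 1 / (N : ℝ) * ((j.val : ℤ) : ℝ) + ω * t = ω * t + (j.val : ℝ) / N := by
      push_cast; ring
    rw [hL, hc1, hc2, hc0, harg, hA]
    simp only [add_apply, waveOp_apply, blochPerturbation, smul_apply, shift_apply,
      Pi.add_apply, Pi.smul_apply, Matrix.mulVec_smul]
    push_cast
    rw [← he1, ← he2, ← sub_eq_add_neg]
    linear_combination (norm := module) he0 •
      (((-2 : ℂ) * (μ : ℂ)) • V j + (jac f (u (ω * t + (j.val : ℝ) / N))).mulVec (V j))
  rw [floquet]
  simp_rw [hbloch]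
  -- Time is rescaled by 1/ω. For ω < 0 this reverses time, which is harmless because the evolution
  -- runs in both directions.
  have h := evolution_comp_mul hAc (1 / ω) 1
  rw [mul_one] at h
  rw [← h]
  congr 1
  funext r
  ext V j : 2
  have hr : ω * (1 / ω * r) = r := by field_simp
  simp only [hA, hr, add_apply, waveOp_apply, blochPerturbation, smul_apply, shift_apply,
    Pi.add_apply, Pi.smul_apply]
  push_cast
  module

end LatticeOperators

/-! ### The pairing of sequences and the adjoint evolution -/

section Pairing

variable {d : ℕ} (N : ℕ) [NeZero N]

/-- The scalar product of `N`-periodic sequences, antilinear in the first variable. -/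
def pair (W V : ZMod N → Fin d → ℂ) : ℂ := ∑ j, ∑ a, conj (W j a) * V j a

variable {N}

theorem pair_add_right (W V V' : ZMod N → Fin d → ℂ) :
    pair N W (V + V') = pair N W V + pair N W V' := by
  simp [pair, mul_add, Finset.sum_add_distrib]

theorem pair_smul_right (c : ℂ) (W V : ZMod N → Fin d → ℂ) :
    pair N W (c • V) = c * pair N W V := by
  simp only [pair, Pi.smul_apply, smul_eq_mul, Finset.mul_sum]
  exact Finset.sum_congr rfl fun _ _ => Finset.sum_congr rfl fun _ _ => by ring

theorem pair_sub_right (W V V' : ZMod N → Fin d → ℂ) :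
    pair N W (V - V') = pair N W V - pair N W V' := by
  simp [pair, mul_sub, Finset.sum_sub_distrib]

theorem pair_smul_left (c : ℂ) (W V : ZMod N → Fin d → ℂ) :
    pair N (c • W) V = conj c * pair N W V := by
  simp only [pair, Pi.smul_apply, smul_eq_mul, Finset.mul_sum, map_mul]
  exact Finset.sum_congr rfl fun _ _ => Finset.sum_congr rfl fun _ _ => by ring

theorem pair_sub_left (W W' V : ZMod N → Fin d → ℂ) :
    pair N (W - W') V = pair N W V - pair N W' V := by
  simp [pair, sub_mul, Finset.sum_sub_distrib]

theorem pair_single_right (W : ZMod N → Fin d → ℂ) (j : ZMod N) (a : Fin d) :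
    pair N W (Pi.single j (Pi.single a 1)) = conj (W j a) := by
  rw [pair, Finset.sum_eq_single j, Finset.sum_eq_single a]
  · simp
  · intro b _ hb; simp [hb]
  · simp
  · intro i _ hi; simp [hi]
  · simp

theorem pair_single_left (V : ZMod N → Fin d → ℂ) (j : ZMod N) (a : Fin d) :
    pair N (Pi.single j (Pi.single a 1)) V = V j a := by
  rw [pair, Finset.sum_eq_single j, Finset.sum_eq_single a]
  · simp
  · intro b _ hb; simp [hb]
  · simp
  · intro i _ hi; simp [hi]
  · simp

theorem eq_zero_of_pair_left {W : ZMod N → Fin d → ℂ} (h : ∀ V, pair N W V = 0) : W = 0 := by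
  funext j a
  have := h (Pi.single j (Pi.single a 1))
  rw [pair_single_right] at this
  simpa using this

theorem eq_zero_of_pair_right {V : ZMod N → Fin d → ℂ} (h : ∀ W, pair N W V = 0) : V = 0 := by
  funext j a
  have := h (Pi.single j (Pi.single a 1))
  rwa [pair_single_left] at this

theorem exists_pair_eq (ψ : (ZMod N → Fin d → ℂ) →ₗ[ℂ] ℂ) :
    ∃ W : ZMod N → Fin d → ℂ, ∀ V, pair N W V = ψ V := by
  refine ⟨fun j a => conj (ψ (Pi.single j (Pi.single a 1))), fun V => ?_⟩
  have hV : V = ∑ j, ∑ a, V j a • (Pi.single j (Pi.single a 1) : ZMod N → Fin d → ℂ) := by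
    funext i b
    simp only [Finset.sum_apply, Pi.smul_apply, smul_eq_mul]
    rw [Finset.sum_eq_single i, Finset.sum_eq_single b]
    · simp
    · intro c _ hc; simp [hc.symm]
    · simp
    · intro c _ hc; simp [hc.symm]
    · simp
  conv_rhs => rw [hV]
  simp only [map_sum, map_smul, smul_eq_mul, pair, Complex.conj_conj]
  exact Finset.sum_congr rfl fun _ _ => Finset.sum_congr rfl fun _ _ => mul_comm _ _

theorem hasDerivAt_pair {W V : ℝ → ZMod N → Fin d → ℂ} {W' V' : ZMod N → Fin d → ℂ} {t : ℝ}
    (hW : HasDerivAt W W' t) (hV : HasDerivAt V V' t) :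
    HasDerivAt (fun t => pair N (W t) (V t)) (pair N W' (V t) + pair N (W t) V') t := by
  have h : HasDerivAt (fun t => pair N (W t) (V t))
      (∑ j, ∑ a, (conj (W' j a) * V t j a + conj (W t j a) * V' j a)) t := by
    refine HasDerivAt.fun_sum fun j _ => HasDerivAt.fun_sum fun a _ => ?_
    have h1 := hasDerivAt_pi.1 (hasDerivAt_pi.1 hW j) a
    have h2 := hasDerivAt_pi.1 (hasDerivAt_pi.1 hV j) a
    exact h1.star.mul h2
  refine h.congr_deriv ?_
  simp only [pair, Finset.sum_add_distrib]

/-- The formal adjoint of the generator. -/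
theorem pair_waveOp (c₁ c₂ : ℝ) {J : ℝ → Matrix (Fin d) (Fin d) ℂ}
    (hJ : ∀ t a b, conj (J t a b) = J t a b) (t : ℝ) (W V : ZMod N → Fin d → ℂ) :
    pair N (waveOp N (-c₁) (-c₂) (fun ζ => (J ζ).transpose) t W) V +
      pair N W (waveOp N c₁ c₂ J t V) = 0 := by
  have hs : ∀ m : ZMod N, ∀ (W V : ZMod N → Fin d → ℂ),
      ∑ j, ∑ a, conj (W (j + m) a) * V j a = ∑ j, ∑ a, conj (W j a) * V (j - m) a := by
    intro m W V
    rw [← Equiv.sum_comp (Equiv.subRight m)]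
    simp
  have h1 := hs 1 W V
  have h2 := hs (-1) W V
  simp only [← sub_eq_add_neg, sub_neg_eq_add] at h2
  have h3 : ∑ j : ZMod N, ∑ a, conj ((J (t + j.val / N)).transpose.mulVec (W j) a) * V j a =
      ∑ j : ZMod N, ∑ a, conj (W j a) * (J (t + j.val / N)).mulVec (V j) a := by
    refine Finset.sum_congr rfl fun j _ => ?_
    simp only [Matrix.mulVec, dotProduct, map_sum, map_mul, Matrix.transpose_apply, hJ,
      Finset.sum_mul, Finset.mul_sum]
    rw [Finset.sum_comm]
    exact Finset.sum_congr rfl fun _ _ => Finset.sum_congr rfl fun _ _ => by ring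
  have e1 : pair N (waveOp N (-c₁) (-c₂) (fun ζ => (J ζ).transpose) t W) V =
      -(c₁ : ℂ) * (∑ j, ∑ a, conj (W (j + 1) a) * V j a - 2 * ∑ j, ∑ a, conj (W j a) * V j a +
        ∑ j, ∑ a, conj (W (j - 1) a) * V j a) -
      (c₂ : ℂ) * ∑ j : ZMod N, ∑ a, conj ((J (t + j.val / N)).transpose.mulVec (W j) a) * V j a := by
    simp only [pair, waveOp_apply, Pi.add_apply, Pi.smul_apply, Pi.sub_apply, smul_eq_mul,
      Finset.mul_sum, ← Finset.sum_add_distrib, ← Finset.sum_sub_distrib, map_add, map_mul,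
      map_sub, Complex.conj_ofReal, Complex.ofReal_neg, map_neg]
    refine Finset.sum_congr rfl fun _ _ => Finset.sum_congr rfl fun _ _ => ?_
    rw [show conj (2 : ℂ) = 2 from Complex.conj_ofNat 2]
    ring
  have e2 : pair N W (waveOp N c₁ c₂ J t V) =
      (c₁ : ℂ) * (∑ j, ∑ a, conj (W j a) * V (j + 1) a - 2 * ∑ j, ∑ a, conj (W j a) * V j a +
        ∑ j, ∑ a, conj (W j a) * V (j - 1) a) +
      (c₂ : ℂ) * ∑ j : ZMod N, ∑ a, conj (W j a) * (J (t + j.val / N)).mulVec (V j) a := by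
    simp only [pair, waveOp_apply, Pi.add_apply, Pi.smul_apply, Pi.sub_apply, smul_eq_mul,
      Finset.mul_sum, ← Finset.sum_add_distrib, ← Finset.sum_sub_distrib]
    exact Finset.sum_congr rfl fun _ _ => Finset.sum_congr rfl fun _ _ => by ring
  rw [e1, e2, h1, h2, h3]
  ring

/-- Only the forcing changes the pairing with an adjoint solution. Integrated over a period, this
yields the solvability condition. -/
theorem hasDerivAt_pair_adjoint {c₁ c₂ : ℝ} {J : ℝ → Matrix (Fin d) (Fin d) ℂ}
    (hJ : ∀ t a b, conj (J t a b) = J t a b) {W V : ℝ → ZMod N → Fin d → ℂ}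
    {H : ZMod N → Fin d → ℂ} {t : ℝ}
    (hW : HasDerivAt W (waveOp N (-c₁) (-c₂) (fun ζ => (J ζ).transpose) t (W t)) t)
    (hV : HasDerivAt V (waveOp N c₁ c₂ J t (V t) + H) t) :
    HasDerivAt (fun t => pair N (W t) (V t)) (pair N (W t) H) t := by
  refine (hasDerivAt_pair hW hV).congr_deriv ?_
  rw [pair_add_right, ← add_assoc, pair_waveOp c₁ c₂ hJ, zero_add]

/-- The pairing of solutions of the linearized and of the adjoint equations is constant. -/
theorem pair_solution_eq {c₁ c₂ : ℝ} {J : ℝ → Matrix (Fin d) (Fin d) ℂ}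
    (hJ : ∀ t a b, conj (J t a b) = J t a b) {W V : ℝ → ZMod N → Fin d → ℂ}
    (hW : ∀ t, HasDerivAt W (waveOp N (-c₁) (-c₂) (fun ζ => (J ζ).transpose) t (W t)) t)
    (hV : ∀ t, HasDerivAt V (waveOp N c₁ c₂ J t (V t)) t) (t s : ℝ) :
    pair N (W t) (V t) = pair N (W s) (V s) := by
  have h : ∀ t, HasDerivAt (fun t => pair N (W t) (V t)) 0 t := fun t => by
    have := hasDerivAt_pair_adjoint (H := 0) hJ (hW t) (by simpa using hV t)
    simpa [pair] using this
  exact is_const_of_deriv_eq_zero (fun t => (h t).differentiableAt) (fun t => (h t).deriv) t s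

/-- Existence of a periodic solution of the adjoint equation that is normalized against a simple
periodic solution of the linearized equation. -/
theorem exists_periodic_adjoint_solution {c₁ c₂ : ℝ} {J : ℝ → Matrix (Fin d) (Fin d) ℂ}
    (hJc : Continuous J) (hJp : Function.Periodic J 1) (hJ : ∀ t a b, conj (J t a b) = J t a b)
    {φ : ZMod N → Fin d → ℂ} (hφ : φ ≠ 0) (hSφ : evolution (waveOp N c₁ c₂ J) 1 0 φ = φ)
    (hgen : Module.End.maxGenEigenspace (evolution (waveOp N c₁ c₂ J) 1 0 :
      (ZMod N → Fin d → ℂ) →ₗ[ℂ] (ZMod N → Fin d → ℂ)) 1 = Submodule.span ℂ {φ}) :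
    ∃ W : ℝ → ZMod N → Fin d → ℂ, Function.Periodic W 1 ∧ pair N (W 0) φ = 1 ∧
      ∀ t, HasDerivAt W (waveOp N (-c₁) (-c₂) (fun ζ => (J ζ).transpose) t (W t)) t := by
  set A := waveOp N c₁ c₂ J with hA
  set B := waveOp N (-c₁) (-c₂) (fun ζ => (J ζ).transpose) with hB
  have hAc : Continuous A := continuous_waveOp N _ _ hJc
  have hBc : Continuous B := continuous_waveOp N _ _ hJc.matrix_transpose
  set S := evolution A 1 0 with hS
  -- The adjoint time-one map is the inverse of the adjoint of S. In particular S is invertible, and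
  -- S-invariant functionals correspond to fixed points of the adjoint map.
  have hpair : ∀ W₀ V₀, pair N (evolution B 1 0 W₀) (S V₀) = pair N W₀ V₀ := fun W₀ V₀ => by
    have := pair_solution_eq hJ (fun t => hasDerivAt_evolution_apply hBc W₀ t 0)
      (fun t => hasDerivAt_evolution_apply hAc V₀ t 0) 1 0
    simpa [evolution_self] using this
  have hinj : Function.Injective (S : (ZMod N → Fin d → ℂ) →ₗ[ℂ] (ZMod N → Fin d → ℂ)) := by
    rw [injective_iff_map_eq_zero]
    intro V hV
    refine eq_zero_of_pair_right fun W₀ => ?_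
    rw [← hpair, show S V = 0 from hV]
    simp [pair]
  have hsurj := LinearMap.surjective_of_injective hinj
  have hnot : φ ∉ LinearMap.range
      ((S : (ZMod N → Fin d → ℂ) →ₗ[ℂ] (ZMod N → Fin d → ℂ)) - LinearMap.id) := by
    rintro ⟨x, hx⟩
    exact sub_self_ne_of_simple hφ hSφ hgen x hx
  -- A functional killing the range of S - Id is S-invariant; being nonzero at φ, it can be
  -- normalized there.
  obtain ⟨ψ, hψφ, hψ⟩ := Submodule.exists_le_ker_of_notMem hnot
  obtain ⟨W₀, hW₀⟩ := exists_pair_eq ((ψ φ)⁻¹ • ψ)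
  have hinv : ∀ V, pair N W₀ (S V) = pair N W₀ V := fun V => by
    have : ψ (S V - V) = 0 := hψ ⟨V, rfl⟩
    rw [← sub_eq_zero, ← pair_sub_right, hW₀]
    simp [this]
  have hper : evolution B 1 0 W₀ = W₀ := by
    rw [← sub_eq_zero]
    refine eq_zero_of_pair_left fun V => ?_
    obtain ⟨V', rfl⟩ := hsurj V
    have h1 := hpair W₀ V'
    have h2 := hinv V'
    rw [pair_sub_left]
    exact sub_eq_zero.2 (h1.trans h2.symm)
  have hW := fun t => hasDerivAt_evolution_apply hBc W₀ t 0
  refine ⟨fun t => evolution B t 0 W₀, ?_, ?_, hW⟩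
  · have hBp : Function.Periodic B 1 := waveOp_periodic N _ _ fun t => by
      simp only [hJp t]
    have hsol : ∀ t, HasDerivAt (fun t => evolution B (t + 1) 0 W₀)
        (B t (evolution B (t + 1) 0 W₀)) t := fun t => by
      have := (hW (t + 1)).comp_add_const t 1
      rwa [hBp t] at this
    exact fun t => congrFun (linearODE_unique hBc hsol hW (t₀ := 0)
      (by simp [hper, evolution_self])) t
  · simp [evolution_self, hW₀, hψφ]

end Pairing

/-! ### Sampling of periodic functions along the lattice -/

section Sampling

variable {d : ℕ} (N : ℕ)

/-- The `N`-periodic sequence of samples `h(t + j/N)`. -/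
def sample (h : ℝ → Fin d → ℂ) (t : ℝ) : ZMod N → Fin d → ℂ := fun j => h (t + j.val / N)

variable {N}

theorem sample_periodic {h : ℝ → Fin d → ℂ} (hh : Function.Periodic h 1) :
    Function.Periodic (sample N h) 1 := by
  intro t
  funext j
  rw [sample, sample, add_right_comm, hh]

theorem continuous_sample {h : ℝ → Fin d → ℂ} (hh : Continuous h) : Continuous (sample N h) :=
  continuous_pi fun _ => hh.comp (by fun_prop)

variable [NeZero N]

/-- The wrap-around of the representative costs a multiple of N, hence an integer after division by
N, which 1-periodic functions do not see. -/
theorem exists_int_val_add_one (j : ZMod N) :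
    ∃ m : ℤ, (((j + 1).val : ℕ) : ℝ) / N = (j.val : ℝ) / N + 1 / N + m := by
  have h : (((j + 1).val : ℤ) : ZMod N) = (((j.val : ℤ) + 1 : ℤ) : ZMod N) := by simp
  rw [eq_comm, ZMod.intCast_eq_intCast_iff_dvd_sub] at h
  obtain ⟨m, hm⟩ := h
  refine ⟨m, ?_⟩
  have hN : (N : ℝ) ≠ 0 := Nat.cast_ne_zero.2 (NeZero.ne N)
  have hm' : ((j + 1).val : ℝ) - ((j.val : ℝ) + 1) = N * m := by exact_mod_cast hm
  field_simp
  linarith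

theorem apply_add_val_add_one {E : Type*} {g : ℝ → E} (hg : Function.Periodic g 1) (x : ℝ)
    (j : ZMod N) : g (x + (j + 1).val / N) = g (x + 1 / N + j.val / N) := by
  obtain ⟨m, hm⟩ := exists_int_val_add_one j
  have := hg.int_mul m (x + 1 / N + j.val / N)
  rw [hm, ← this]
  congr 1
  ring

theorem apply_sub_val_add_one {E : Type*} {g : ℝ → E} (hg : Function.Periodic g 1) (x : ℝ)
    (j : ZMod N) : g (x - (j + 1).val / N) = g (x - 1 / N - j.val / N) := by
  obtain ⟨m, hm⟩ := exists_int_val_add_one j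
  have := hg.int_mul m (x - (j + 1).val / N)
  rw [← this]
  congr 1
  rw [hm]
  ring

variable (N)

/-- The function `∑_j W_j(t - j/N)`, the transpose of `sample`. -/
def unsample (W : ℝ → ZMod N → Fin d → ℂ) (t : ℝ) : Fin d → ℂ := ∑ j : ZMod N, W (t - j.val / N) j

variable {N}

theorem sample_add_one {h : ℝ → Fin d → ℂ} (hh : Function.Periodic h 1) (t : ℝ) (j : ZMod N) :
    sample N h t (j + 1) = h (t + j.val / N + 1 / N) := by
  rw [sample, apply_add_val_add_one hh, add_right_comm]

theorem sample_sub_one {h : ℝ → Fin d → ℂ} (hh : Function.Periodic h 1) (t : ℝ) (j : ZMod N) :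
    sample N h t (j - 1) = h (t + j.val / N - 1 / N) := by
  have h1 := sample_add_one hh (t - 1 / N) (j - 1)
  rw [sub_add_cancel] at h1
  rw [show t + (j.val : ℝ) / N - 1 / N = t - 1 / N + j.val / N by ring]
  rw [sample] at h1 ⊢
  rw [h1]
  congr 1
  ring

/-- Samples of a periodic solution of a functional differential equation solve the
corresponding lattice equation. -/
theorem hasDerivAt_sample {c₁ c₂ : ℝ} {J : ℝ → Matrix (Fin d) (Fin d) ℂ} {h g : ℝ → Fin d → ℂ}
    (hh : Function.Periodic h 1)
    (hd : ∀ ζ, HasDerivAt h ((c₁ : ℂ) • (h (ζ + 1 / N) - (2 : ℂ) • h ζ + h (ζ - 1 / N)) +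
      (c₂ : ℂ) • (J ζ).mulVec (h ζ) + g ζ) ζ) (t : ℝ) :
    HasDerivAt (sample N h) (waveOp N c₁ c₂ J t (sample N h t) + sample N g t) t := by
  refine hasDerivAt_pi.2 fun j => ?_
  refine ((hd (t + j.val / N)).comp_add_const t (j.val / N)).congr_deriv ?_
  rw [Pi.add_apply, waveOp_apply, sample_add_one hh, sample_sub_one hh]
  rfl

theorem unsample_periodic {W : ℝ → ZMod N → Fin d → ℂ} (hW : Function.Periodic W 1) :
    Function.Periodic (unsample N W) 1 := by
  intro t
  refine Finset.sum_congr rfl fun j _ => ?_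
  rw [add_sub_right_comm, hW]

theorem continuous_unsample {W : ℝ → ZMod N → Fin d → ℂ} (hW : Continuous W) :
    Continuous (unsample N W) :=
  continuous_finsetSum _ fun j _ => (continuous_apply j).comp (hW.comp (by fun_prop))

/-- At time ζ - j/N the potential acts on site j by J((ζ - j/N) + j/N) = J(ζ), the same matrix for
all j, so it leaves the sum. Reindexing by j ± 1 turns the lattice shifts into translations by ±1/N.
-/
theorem hasDerivAt_unsample {c₁ c₂ : ℝ} {J : ℝ → Matrix (Fin d) (Fin d) ℂ}
    {W : ℝ → ZMod N → Fin d → ℂ} (hWp : Function.Periodic W 1)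
    (hW : ∀ t, HasDerivAt W (waveOp N c₁ c₂ J t (W t)) t) (ζ : ℝ) :
    HasDerivAt (unsample N W)
      ((c₁ : ℂ) • (unsample N W (ζ + 1 / N) - (2 : ℂ) • unsample N W ζ +
        unsample N W (ζ - 1 / N)) + (c₂ : ℂ) • (J ζ).mulVec (unsample N W ζ)) ζ := by
  have h : HasDerivAt (unsample N W)
      (∑ j : ZMod N, waveOp N c₁ c₂ J (ζ - j.val / N) (W (ζ - j.val / N)) j) ζ := by
    refine HasDerivAt.fun_sum fun j _ => ?_
    exact (hasDerivAt_pi.1 (hW (ζ - j.val / N)) j).comp_sub_const ζ (j.val / N)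
  refine h.congr_deriv ?_
  have hp : ∑ j : ZMod N, W (ζ - j.val / N) (j + 1) = unsample N W (ζ + 1 / N) := by
    refine Eq.trans (Finset.sum_congr rfl fun j _ => ?_) (Equiv.sum_comp (Equiv.addRight 1)
      fun j : ZMod N => W (ζ + 1 / N - j.val / N) j)
    rw [Equiv.coe_addRight, apply_sub_val_add_one hWp, add_sub_cancel_right]
  have hm : ∑ j : ZMod N, W (ζ - j.val / N) (j - 1) = unsample N W (ζ - 1 / N) := by
    rw [unsample, ← Equiv.sum_comp (Equiv.addRight (1 : ZMod N))]
    refine Finset.sum_congr rfl fun j _ => ?_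
    simp only [Equiv.coe_addRight, apply_sub_val_add_one hWp, add_sub_cancel_right]
  simp only [waveOp_apply, sub_add_cancel, Finset.sum_add_distrib, ← Finset.smul_sum,
    Finset.sum_sub_distrib, hp, hm]
  congr 2
  rw [unsample, Matrix.mulVec_sum]

/-- Translating the j-th term by j/N leaves its integral over a period unchanged. This converts
orthogonality in L² of the circle into the lattice solvability condition. -/
theorem inner01_unsample {W : ℝ → ZMod N → Fin d → ℂ} (hWp : Function.Periodic W 1)
    (hWc : Continuous W) {h : ℝ → Fin d → ℂ} (hp : Function.Periodic h 1) (hc : Continuous h) :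
    inner01 (unsample N W) h = ∫ ζ in (0 : ℝ)..1, pair N (W ζ) (sample N h ζ) := by
  have hWja : ∀ j a, Continuous fun ζ => W ζ j a := fun j a =>
    (continuous_apply a).comp ((continuous_apply j).comp hWc)
  have hha : ∀ a, Continuous fun ζ => h ζ a := fun a => (continuous_apply a).comp hc
  let g : ZMod N → ℝ → ℂ := fun j ζ => ∑ a, conj (W (ζ - j.val / N) j a) * h ζ a
  have hgc : ∀ j, Continuous (g j) := fun j => continuous_finsetSum _ fun a _ =>
    (Complex.continuous_conj.comp ((hWja j a).comp (by fun_prop))).mul (hha a)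
  have hgp : ∀ j, Function.Periodic (g j) 1 := fun j ζ => by
    simp only [g]
    rw [add_sub_right_comm, hWp, hp]
  have h1 : inner01 (unsample N W) h = ∑ j, ∫ ζ in (0 : ℝ)..1, g j ζ := by
    rw [← intervalIntegral.integral_finsetSum fun j _ => (hgc j).intervalIntegrable _ _]
    rw [inner01]
    congr 1
    funext ζ
    simp only [g, unsample, Finset.sum_apply, map_sum, Finset.sum_mul]
    exact Finset.sum_comm
  have h2 : ∀ j, ∫ ζ in (0 : ℝ)..1, g j ζ =
      ∫ ζ in (0 : ℝ)..1, ∑ a, conj (W ζ j a) * h (ζ + j.val / N) a := fun j => by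
    have e1 := (hgp j).intervalIntegral_add_eq 0 (j.val / N)
    have e2 := intervalIntegral.integral_comp_add_right (a := 0) (b := 1) (g j) ((j.val : ℝ) / N)
    rw [zero_add] at e1 e2
    rw [e1, add_comm (_ / _) (1 : ℝ), ← e2]
    simp [g]
  rw [h1]
  simp_rw [h2]
  have h3 : ∀ j : ZMod N, Continuous fun ζ => ∑ a, conj (W ζ j a) * h (ζ + j.val / N) a :=
    fun j => continuous_finsetSum _ fun a _ => (Complex.continuous_conj.comp (hWja j a)).mul
      ((hha a).comp (by fun_prop))
  rw [← intervalIntegral.integral_finsetSum fun j _ => (h3 j).intervalIntegrable _ _]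
  rfl

end Sampling

/-! ### Classical solutions of the adjoint equation -/

section AdjointKernel

variable {d : ℕ} {μ k ω : ℝ} {f : (Fin d → ℝ) → Fin d → ℝ} {u : ℝ → Fin d → ℝ}
  {w : ℝ → Fin d → ℂ}

/-- Elements of the kernel of the adjoint operator are classical solutions. -/
theorem InKerAdjoint.hasDerivAt (hω : ω ≠ 0) (hJ : Continuous fun ζ => jac f (u ζ))
    (hw : InKerAdjoint μ f u k ω w) (ζ : ℝ) :
    HasDerivAt w (((-(μ / ω) : ℝ) : ℂ) • (w (ζ + k) - (2 : ℂ) • w ζ + w (ζ - k)) +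
      ((-(1 / ω) : ℝ) : ℂ) • (jac f (u ζ)).transpose.mulVec (w ζ)) ζ := by
  obtain ⟨g, hg, hae⟩ := hw
  have hωC : (ω : ℂ) ≠ 0 := Complex.ofReal_ne_zero.2 hω
  have hint : ∀ a b : ℝ, IntervalIntegrable g volume a b := by
    intro a b
    refine hg.periodic_deriv.intervalIntegrable one_ne_zero (t := 0) ?_ a b
    rw [zero_add, intervalIntegrable_iff_integrableOn_Ioc_of_le zero_le_one]
    exact hg.memLp.integrable (by norm_num)
  have hprim : ∀ x, w x = w 0 + ∫ y in (0 : ℝ)..x, g y := fun x => by rw [hg.integral_eq]; abel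
  have hwc : Continuous w := by
    rw [funext hprim]
    exact continuous_const.add (intervalIntegral.continuous_primitive hint 0)
  set G : ℝ → Fin d → ℂ := fun ζ =>
    ((-(μ / ω) : ℝ) : ℂ) • (w (ζ + k) - (2 : ℂ) • w ζ + w (ζ - k)) +
      ((-(1 / ω) : ℝ) : ℂ) • (jac f (u ζ)).transpose.mulVec (w ζ) with hG
  have hGc : Continuous G := by
    have h1 : Continuous fun ζ => (jac f (u ζ)).transpose.mulVec (w ζ) :=
      hJ.matrix_transpose.matrix_mulVec hwc
    have h2 : Continuous fun ζ => w (ζ + k) := hwc.comp (by fun_prop)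
    have h3 : Continuous fun ζ => w (ζ - k) := hwc.comp (by fun_prop)
    fun_prop
  -- The equation identifies the weak derivative almost everywhere with a continuous function, so w
  -- is a primitive of the latter and is C¹.
  have hgG : g =ᵐ[volume] G := by
    filter_upwards [hae] with ζ hζ
    have h1 : (ω : ℂ) • g ζ = (ω : ℂ) • G ζ := by
      have h2 : (ω : ℂ) • G ζ = -((μ : ℂ) • (w (ζ - k) - (2 : ℂ) • w ζ + w (ζ + k)) +
          (jac f (u ζ)).transpose.mulVec (w ζ)) := by
        simp only [hG]
        push_cast
        match_scalars <;> field_simp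
      rw [h2, eq_neg_iff_add_eq_zero, ← add_assoc]
      exact hζ
    exact smul_right_injective _ hωC h1
  have hprim' : w = fun x => w 0 + ∫ y in (0 : ℝ)..x, G y := by
    funext x
    rw [hprim x]
    congr 1
    exact intervalIntegral.integral_congr_ae (hgG.mono fun y hy _ => hy)
  have hd := (intervalIntegral.integral_hasDerivAt_right (hGc.intervalIntegrable 0 ζ)
    (hGc.stronglyMeasurableAtFilter volume (𝓝 ζ)) hGc.continuousAt).const_add (w 0)
  rw [← hprim'] at hd
  exact hd

/-- Periodic classical solutions of the adjoint equation belong to its kernel. -/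
theorem inKerAdjoint_of_hasDerivAt (hω : ω ≠ 0) (hJ : Continuous fun ζ => jac f (u ζ))
    (hJp : Function.Periodic (fun ζ => jac f (u ζ)) 1) (hwp : Function.Periodic w 1)
    (hw : ∀ ζ, HasDerivAt w (((-(μ / ω) : ℝ) : ℂ) • (w (ζ + k) - (2 : ℂ) • w ζ + w (ζ - k)) +
      ((-(1 / ω) : ℝ) : ℂ) • (jac f (u ζ)).transpose.mulVec (w ζ)) ζ) :
    InKerAdjoint μ f u k ω w := by
  have hωC : (ω : ℂ) ≠ 0 := Complex.ofReal_ne_zero.2 hω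
  have hwc : Continuous w := continuous_iff_continuousAt.2 fun ζ => (hw ζ).continuousAt
  set G : ℝ → Fin d → ℂ := fun ζ =>
    ((-(μ / ω) : ℝ) : ℂ) • (w (ζ + k) - (2 : ℂ) • w ζ + w (ζ - k)) +
      ((-(1 / ω) : ℝ) : ℂ) • (jac f (u ζ)).transpose.mulVec (w ζ) with hG
  have hGc : Continuous G := by
    have h1 : Continuous fun ζ => (jac f (u ζ)).transpose.mulVec (w ζ) :=
      hJ.matrix_transpose.matrix_mulVec hwc
    have h2 : Continuous fun ζ => w (ζ + k) := hwc.comp (by fun_prop)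
    have h3 : Continuous fun ζ => w (ζ - k) := hwc.comp (by fun_prop)
    fun_prop
  refine ⟨G, ⟨hwp, fun ζ => ?_, ?_, fun a b => ?_⟩, Eventually.of_forall fun ζ => ?_⟩
  · have h1 : w (ζ + 1 + k) = w (ζ + k) := by rw [add_right_comm, hwp]
    have h2 : w (ζ + 1 - k) = w (ζ - k) := by rw [add_sub_right_comm, hwp]
    have h3 : jac f (u (ζ + 1)) = jac f (u ζ) := hJp ζ
    simp only [hG, h1, h2, h3, hwp ζ]
  · obtain ⟨C, hC⟩ := (isCompact_Icc (a := (0 : ℝ)) (b := 1)).exists_bound_of_continuousOn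
      hGc.continuousOn
    exact MemLp.of_bound hGc.aestronglyMeasurable C
      (ae_restrict_of_forall_mem measurableSet_Ioc fun ζ hζ => hC ζ (Ioc_subset_Icc_self hζ))
  · exact intervalIntegral.integral_eq_sub_of_hasDerivAt (fun ζ _ => hw ζ)
      (hGc.intervalIntegrable a b)
  · simp only [hG]
    push_cast
    match_scalars <;> field_simp <;> ring

end AdjointKernel

/-! ### Differentiation of the profile equation -/

section ProfileEquation

variable {d : ℕ}

/-- Complexification, as a continuous real linear map. -/
def toCL (d : ℕ) : (Fin d → ℝ) →L[ℝ] (Fin d → ℂ) :=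
  ContinuousLinearMap.pi fun a => Complex.ofRealCLM ∘L ContinuousLinearMap.proj a

theorem toC_add (v w : Fin d → ℝ) : toC (v + w) = toC v + toC w := (toCL d).map_add v w

theorem toC_sub (v w : Fin d → ℝ) : toC (v - w) = toC v - toC w := (toCL d).map_sub v w

theorem toC_smul (c : ℝ) (v : Fin d → ℝ) : toC (c • v) = (c : ℂ) • toC v := by
  funext a; simp [toC]

theorem _root_.HasDerivAt.toC {h : ℝ → Fin d → ℝ} {h' : Fin d → ℝ} {t : ℝ}
    (hh : HasDerivAt h h' t) : HasDerivAt (fun t => toC (h t)) (toC h') t :=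
  (toCL d).hasFDerivAt.comp_hasDerivAt t hh

theorem jac_mulVec_toC (f : (Fin d → ℝ) → Fin d → ℝ) (x v : Fin d → ℝ) :
    (jac f x).mulVec (toC v) = toC (fderiv ℝ f x v) := by
  have hv : v = ∑ b, v b • (Pi.single b 1 : Fin d → ℝ) := by
    funext a
    simp [Finset.sum_apply, Pi.single_apply]
  funext a
  conv_rhs => rw [hv]
  simp only [Matrix.mulVec, dotProduct, jac, Matrix.of_apply, toC, map_sum, map_smul,
    Finset.sum_apply, Pi.smul_apply, smul_eq_mul]
  push_cast
  exact Finset.sum_congr rfl fun b _ => mul_comm _ _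

theorem conj_jac (f : (Fin d → ℝ) → Fin d → ℝ) (x : Fin d → ℝ) (a b : Fin d) :
    conj (jac f x a b) = jac f x a b := by
  simp [jac]

theorem continuous_jac {f : (Fin d → ℝ) → Fin d → ℝ} (hf : ContDiff ℝ ((⊤ : ℕ∞) : WithTop ℕ∞) f)
    {u : ℝ → Fin d → ℝ} (hu : Continuous u) : Continuous fun ζ => jac f (u ζ) := by
  refine continuous_matrix fun a b => Complex.continuous_ofReal.comp ?_
  have h1 : Continuous fun ζ => fderiv ℝ f (u ζ) := (hf.continuous_fderiv (by simp)).comp hu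
  exact (continuous_apply a).comp (h1.clm_apply continuous_const)

variable {μ : ℝ} {f : (Fin d → ℝ) → Fin d → ℝ} {I : Set ℝ} {u : ℝ → ℝ → Fin d → ℝ} {ω : ℝ → ℝ}
  {k : ℝ}

theorem IsWaveFamily.contDiffAt (hfam : IsWaveFamily μ f I u ω) (hI : IsOpen I) (hk : k ∈ I)
    (ζ : ℝ) : ContDiffAt ℝ ((⊤ : ℕ∞) : WithTop ℕ∞) (fun p : ℝ × ℝ => u p.1 p.2) (k, ζ) :=
  hfam.smooth_profile.contDiffAt ((hI.prod isOpen_univ).mem_nhds ⟨hk, trivial⟩)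

theorem IsWaveFamily.hasFDerivAt (hfam : IsWaveFamily μ f I u ω) (hI : IsOpen I) (hk : k ∈ I)
    (ζ : ℝ) : HasFDerivAt (fun p : ℝ × ℝ => u p.1 p.2)
      (fderiv ℝ (fun p : ℝ × ℝ => u p.1 p.2) (k, ζ)) (k, ζ) :=
  ((hfam.contDiffAt hI hk ζ).differentiableAt (by simp)).hasFDerivAt

theorem IsWaveFamily.hasDerivAt_phase (hfam : IsWaveFamily μ f I u ω) (hI : IsOpen I)
    (hk : k ∈ I) (ζ : ℝ) :
    HasDerivAt (u k) (fderiv ℝ (fun p : ℝ × ℝ => u p.1 p.2) (k, ζ) (0, 1)) ζ := by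
  have h2 : HasDerivAt (fun ζ : ℝ => ((k, ζ) : ℝ × ℝ)) (0, 1) ζ :=
    (hasDerivAt_const ζ k).prodMk (hasDerivAt_id ζ)
  exact (hfam.hasFDerivAt hI hk ζ).comp_hasDerivAt ζ h2

theorem IsWaveFamily.hasDerivAt_wavenumber (hfam : IsWaveFamily μ f I u ω) (hI : IsOpen I)
    (hk : k ∈ I) (ζ : ℝ) :
    HasDerivAt (fun κ => u κ ζ) (fderiv ℝ (fun p : ℝ × ℝ => u p.1 p.2) (k, ζ) (1, 0)) k := by
  have h2 : HasDerivAt (fun κ : ℝ => ((κ, ζ) : ℝ × ℝ)) (1, 0) k :=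
    (hasDerivAt_id k).prodMk (hasDerivAt_const k ζ)
  exact (hfam.hasFDerivAt hI hk ζ).comp_hasDerivAt k h2

/-- In the profile equation k enters both the family and the translations ζ ± k. The cases c = 1,
-1, 0 provide all the terms, and c • u' is the source of the first order Bloch forcing. -/
theorem IsWaveFamily.hasDerivAt_diagonal (hfam : IsWaveFamily μ f I u ω) (hI : IsOpen I)
    (hk : k ∈ I) (ζ c : ℝ) :
    HasDerivAt (fun κ => u κ (ζ + c * κ))
      (deriv (fun κ => u κ (ζ + c * k)) k + c • deriv (u k) (ζ + c * k)) k := by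
  have h2 : HasDerivAt (fun κ : ℝ => ((κ, ζ + c * κ) : ℝ × ℝ)) (1, c) k := by
    have := ((hasDerivAt_id k).const_mul c).const_add ζ
    simpa using (hasDerivAt_id k).prodMk this
  have h3 := (hfam.hasFDerivAt hI hk (ζ + c * k)).comp_hasDerivAt k h2
  refine h3.congr_deriv ?_
  rw [(hfam.hasDerivAt_wavenumber hI hk _).deriv, (hfam.hasDerivAt_phase hI hk _).deriv,
    ← map_smul, ← map_add]
  simp

theorem IsWaveFamily.continuous_profile (hfam : IsWaveFamily μ f I u ω) (hI : IsOpen I)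
    (hk : k ∈ I) : Continuous (u k) :=
  continuous_iff_continuousAt.2 fun ζ => (hfam.hasDerivAt_phase hI hk ζ).continuousAt

theorem IsWaveFamily.periodic_dζ (hfam : IsWaveFamily μ f I u ω) (hk : k ∈ I) :
    Function.Periodic (dζ u k) 1 := by
  intro ζ
  have h := congrFun (congrArg deriv (funext (hfam.periodic k hk))) ζ
  rw [deriv_comp_add_const] at h
  exact congrArg toC h

theorem IsWaveFamily.periodic_dk (hfam : IsWaveFamily μ f I u ω) (hI : IsOpen I) (hk : k ∈ I) :
    Function.Periodic (dk u k) 1 := by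
  intro ζ
  refine congrArg toC (Filter.EventuallyEq.deriv_eq ?_)
  filter_upwards [hI.mem_nhds hk] with κ hκ
  exact hfam.periodic κ hκ ζ

/-- The phase derivative of the profile solves the linearized profile equation. -/
theorem IsWaveFamily.hasDerivAt_dζ (hfam : IsWaveFamily μ f I u ω) (hI : IsOpen I) (hk : k ∈ I)
    (hf : ContDiff ℝ ((⊤ : ℕ∞) : WithTop ℕ∞) f) (hω : ω k ≠ 0) (ζ : ℝ) :
    HasDerivAt (dζ u k) (((μ / ω k : ℝ) : ℂ) • (dζ u k (ζ + k) - (2 : ℂ) • dζ u k ζ +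
      dζ u k (ζ - k)) + ((1 / ω k : ℝ) : ℂ) • (jac f (u k ζ)).mulVec (dζ u k ζ)) ζ := by
  have hu : ∀ ζ, HasDerivAt (u k) (deriv (u k) ζ) ζ := fun ζ =>
    (hfam.hasDerivAt_phase hI hk ζ).differentiableAt.hasDerivAt
  have heq : deriv (u k) = fun ζ => (1 / ω k) •
      (μ • (u k (ζ + k) - (2 : ℝ) • u k ζ + u k (ζ - k)) + f (u k ζ)) := by
    funext ζ
    rw [← hfam.profile_eq k hk ζ, smul_smul, one_div_mul_cancel hω, one_smul]
  have hfd : HasDerivAt (fun ζ => f (u k ζ)) (fderiv ℝ f (u k ζ) (deriv (u k) ζ)) ζ :=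
    ((hf.differentiable (by simp)) (u k ζ)).hasFDerivAt.comp_hasDerivAt ζ (hu ζ)
  have hR : HasDerivAt (deriv (u k)) ((1 / ω k) • (μ • (deriv (u k) (ζ + k) -
      (2 : ℝ) • deriv (u k) ζ + deriv (u k) (ζ - k)) + fderiv ℝ f (u k ζ) (deriv (u k) ζ))) ζ := by
    conv => arg 1; rw [heq]
    exact ((((((hu (ζ + k)).comp_add_const ζ k).sub ((hu ζ).const_smul (2 : ℝ))).add
      ((hu (ζ - k)).comp_sub_const ζ k)).const_smul μ).add hfd).const_smul (1 / ω k)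
  refine hR.toC.congr_deriv ?_
  simp only [dζ, jac_mulVec_toC, toC_smul, toC_add, toC_sub]
  push_cast
  module

/-- Differentiating the profile equation in k produces ∂_k ∂_ζ u, while the equation for ∂_k u needs
∂_ζ ∂_k u. Symmetry of the second derivative identifies them. -/
theorem IsWaveFamily.exists_mixed_derivative (hfam : IsWaveFamily μ f I u ω) (hI : IsOpen I)
    (hk : k ∈ I) (ζ : ℝ) :
    ∃ m, HasDerivAt (fun ζ => deriv (fun κ => u κ ζ) k) m ζ ∧
      HasDerivAt (fun κ => deriv (u κ) ζ) m k := by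
  set U : ℝ × ℝ → Fin d → ℝ := fun p => u p.1 p.2 with hU
  have hUc : ContDiffAt ℝ 2 U (k, ζ) :=
    (hfam.contDiffAt hI hk ζ).of_le (WithTop.coe_le_coe.2 (le_top : (2 : ℕ∞) ≤ ⊤))
  set D2 := fderiv ℝ (fderiv ℝ U) (k, ζ) with hD2
  have hfd2 : HasFDerivAt (fderiv ℝ U) D2 (k, ζ) :=
    ((hUc.fderiv_right (m := 1) (by norm_num)).differentiableAt (by simp)).hasFDerivAt
  have hsymm : D2 (0, 1) (1, 0) = D2 (1, 0) (0, 1) :=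
    (hUc.isSymmSndFDerivAt (by simp)).eq _ _
  have happ : ∀ v : ℝ × ℝ, HasFDerivAt (fun p => fderiv ℝ U p v)
      (ContinuousLinearMap.apply ℝ (Fin d → ℝ) v ∘L D2) (k, ζ) := fun v =>
    (ContinuousLinearMap.apply ℝ (Fin d → ℝ) v).hasFDerivAt.comp (k, ζ) hfd2
  refine ⟨D2 (0, 1) (1, 0), ?_, ?_⟩
  · have h2 : HasDerivAt (fun ζ : ℝ => ((k, ζ) : ℝ × ℝ)) (0, 1) ζ :=
      (hasDerivAt_const ζ k).prodMk (hasDerivAt_id ζ)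
    have h3 : HasDerivAt (fun ζ => fderiv ℝ U (k, ζ) (1, 0)) (D2 (0, 1) (1, 0)) ζ :=
      (happ (1, 0)).comp_hasDerivAt ζ h2
    exact h3.congr_of_eventuallyEq (Eventually.of_forall fun ζ =>
      (hfam.hasDerivAt_wavenumber hI hk ζ).deriv)
  · rw [hsymm]
    have h2 : HasDerivAt (fun κ : ℝ => ((κ, ζ) : ℝ × ℝ)) (1, 0) k :=
      (hasDerivAt_id k).prodMk (hasDerivAt_const k ζ)
    have h3 : HasDerivAt (fun κ => fderiv ℝ U (κ, ζ) (0, 1)) (D2 (1, 0) (0, 1)) k :=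
      HasFDerivAt.comp_hasDerivAt (f := fun κ : ℝ => ((κ, ζ) : ℝ × ℝ)) k (happ (0, 1)) h2
    refine h3.congr_of_eventuallyEq ?_
    filter_upwards [hI.mem_nhds hk] with κ hκ
    exact (hfam.hasDerivAt_phase hI hκ ζ).deriv

/-- The wavenumber derivative of the profile solves the linearized profile equation with the
first order Bloch forcing. -/
theorem IsWaveFamily.hasDerivAt_dk (hfam : IsWaveFamily μ f I u ω) (hI : IsOpen I) (hk : k ∈ I)
    (hf : ContDiff ℝ ((⊤ : ℕ∞) : WithTop ℕ∞) f) (hω : ω k ≠ 0) (ζ : ℝ) :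
    HasDerivAt (dk u k) (((μ / ω k : ℝ) : ℂ) • (dk u k (ζ + k) - (2 : ℂ) • dk u k ζ +
      dk u k (ζ - k)) + ((1 / ω k : ℝ) : ℂ) • (jac f (u k ζ)).mulVec (dk u k ζ) +
      (((μ / ω k : ℝ) : ℂ) • (dζ u k (ζ + k) - dζ u k (ζ - k)) -
        ((deriv ω k / ω k : ℝ) : ℂ) • dζ u k ζ)) ζ := by
  obtain ⟨m, hDζ, hDk⟩ := hfam.exists_mixed_derivative hI hk ζ
  have hωd : HasDerivAt ω (deriv ω k) k :=
    ((hfam.smooth_freq.contDiffAt (hI.mem_nhds hk)).differentiableAt (by simp)).hasDerivAt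
  have hplus := hfam.hasDerivAt_diagonal hI hk ζ 1
  have hminus := hfam.hasDerivAt_diagonal hI hk ζ (-1)
  have hzero := hfam.hasDerivAt_diagonal hI hk ζ 0
  simp only [one_mul, neg_mul, ← sub_eq_add_neg, zero_mul, add_zero, zero_smul, one_smul, neg_smul]
    at hplus hminus hzero
  have hfd : HasDerivAt (fun κ => f (u κ ζ)) (fderiv ℝ f (u k ζ) (deriv (fun κ => u κ ζ) k)) k :=
    ((hf.differentiable (by simp)) (u k ζ)).hasFDerivAt.comp_hasDerivAt k hzero
  have hL := hωd.smul hDk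
  have hR := (((hplus.sub (hzero.const_smul (2 : ℝ))).add hminus).const_smul μ).add hfd
  -- The profile equation holds for all κ near k, so its two sides have the same κ-derivative;
  -- solving for ω m gives the equation for ∂_k u.
  have hLR := hL.unique (hR.congr_of_eventuallyEq (by
    filter_upwards [hI.mem_nhds hk] with κ hκ
    exact hfam.profile_eq κ hκ ζ))
  have hmix : m = (1 / ω k) • (ω k • m) := by
    rw [smul_smul, one_div_mul_cancel hω, one_smul]
  rw [← eq_sub_iff_add_eq] at hLR
  rw [hLR] at hmix
  rw [hmix] at hDζ
  refine hDζ.toC.congr_deriv ?_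
  simp only [dζ, dk, jac_mulVec_toC, toC_smul, toC_add, toC_sub]
  push_cast
  module

end ProfileEquation

/-! ### The adjoint mode and the expansion of the critical multiplier -/

section Main

variable {d : ℕ}

theorem inner01_add_right {w v v' : ℝ → Fin d → ℂ} (hw : Continuous w) (hv : Continuous v)
    (hv' : Continuous v') : inner01 w (v + v') = inner01 w v + inner01 w v' := by
  have hc : ∀ v : ℝ → Fin d → ℂ, Continuous v →
      Continuous fun ζ => ∑ a, conj (w ζ a) * v ζ a := fun v hv =>
    continuous_finsetSum _ fun a _ => (Complex.continuous_conj.comp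
      ((continuous_apply a).comp hw)).mul ((continuous_apply a).comp hv)
  simp only [inner01]
  rw [← intervalIntegral.integral_add ((hc v hv).intervalIntegrable _ _)
    ((hc v' hv').intervalIntegrable _ _)]
  simp [mul_add, Finset.sum_add_distrib]

theorem inner01_smul_right (c : ℂ) (w v : ℝ → Fin d → ℂ) :
    inner01 w (c • v) = c * inner01 w v := by
  simp only [inner01]
  rw [← intervalIntegral.integral_const_mul]
  congr 1
  funext ζ
  simp only [Pi.smul_apply, smul_eq_mul, Finset.mul_sum]
  exact Finset.sum_congr rfl fun _ _ => by ring

/-- The second order forcing is orthogonal to the adjoint mode. -/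
theorem inner01_second_order_forcing {μ ω₀ k : ℝ} {u : ℝ → ℝ → Fin d → ℝ} {w : ℝ → Fin d → ℂ}
    {ν₁ : ℂ} (hw : Continuous w) (hvc : Continuous (dζ u k))
    (hkc : Continuous (dk u k)) (hv : inner01 w (dζ u k) = 1)
    (hdk : inner01 w (dk u k) = 0) :
    inner01 w (fun ζ => ((μ / ω₀ : ℝ) : ℂ) • (dk u k (ζ + k) - dk u k (ζ - k)) +
      (((μ / ω₀ : ℝ) : ℂ) / 2) • (dζ u k (ζ + k) + dζ u k (ζ - k)) -
      (((1 / ω₀ : ℝ) : ℂ) * diffusionCoeff μ u k w) • dζ u k ζ -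
      ν₁ • dk u k ζ) = 0 := by
  set g : ℝ → Fin d → ℂ := fun ζ =>
    (μ : ℂ) • (dk u k (ζ + k) - dk u k (ζ - k)) +
      ((1 / 2 : ℂ) * μ) • (dζ u k (ζ + k) + dζ u k (ζ - k)) with hg
  have hgc : Continuous g := by
    have h1 : Continuous fun ζ : ℝ => dζ u k (ζ + k) := hvc.comp (by fun_prop)
    have h2 : Continuous fun ζ : ℝ => dζ u k (ζ - k) := hvc.comp (by fun_prop)
    have h3 : Continuous fun ζ : ℝ => dk u k (ζ + k) := hkc.comp (by fun_prop)
    have h4 : Continuous fun ζ : ℝ => dk u k (ζ - k) := hkc.comp (by fun_prop)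
    fun_prop
  set D := diffusionCoeff μ u k w with hD
  have hgD : inner01 w g = D := rfl
  -- The forcing is (g - D u')/ω₀ - ν₁ ∂_k u. Pairing with w gives (D - D)/ω₀, and the normalization
  -- removes the last term whatever ν₁ is.
  have hsplit : (fun ζ => ((μ / ω₀ : ℝ) : ℂ) •
      (dk u k (ζ + k) - dk u k (ζ - k)) +
      (((μ / ω₀ : ℝ) : ℂ) / 2) • (dζ u k (ζ + k) + dζ u k (ζ - k)) -
      (((1 / ω₀ : ℝ) : ℂ) * D) • dζ u k ζ - ν₁ • dk u k ζ) =
      ((1 / ω₀ : ℝ) : ℂ) • g +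
        ((-(((1 / ω₀ : ℝ) : ℂ) * D)) • dζ u k + (-ν₁) • dk u k) := by
    funext ζ
    simp only [Pi.add_apply, Pi.smul_apply, hg]
    push_cast
    module
  rw [hsplit, inner01_add_right hw (by fun_prop) (by fun_prop),
    inner01_add_right hw (by fun_prop) (by fun_prop), inner01_smul_right, inner01_smul_right,
    inner01_smul_right, hgD, hv, hdk]
  ring

variable {N : ℕ} [NeZero N]

theorem hasDerivAt_sample_homogeneous {c₁ c₂ : ℝ} {J : ℝ → Matrix (Fin d) (Fin d) ℂ}
    {h : ℝ → Fin d → ℂ} (hh : Function.Periodic h 1)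
    (hd : ∀ ζ, HasDerivAt h ((c₁ : ℂ) • (h (ζ + 1 / N) - (2 : ℂ) • h ζ + h (ζ - 1 / N)) +
      (c₂ : ℂ) • (J ζ).mulVec (h ζ)) ζ) (t : ℝ) :
    HasDerivAt (sample N h) (waveOp N c₁ c₂ J t (sample N h t)) t := by
  have := hasDerivAt_sample (N := N) (g := 0) (J := J) (c₁ := c₁) (c₂ := c₂) hh
    (fun ζ => (hd ζ).congr_deriv (add_zero _).symm) t
  exact this.congr_deriv (add_zero _)

/-- A periodic solution of the adjoint equation is determined by its pairing with a simple
periodic solution of the linearized equation. -/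
theorem adjoint_solution_eq_zero {c₁ c₂ : ℝ} {J : ℝ → Matrix (Fin d) (Fin d) ℂ}
    (hJc : Continuous J) (hJ : ∀ t a b, conj (J t a b) = J t a b)
    {φ : ZMod N → Fin d → ℂ} (hφ : φ ≠ 0) (hSφ : evolution (waveOp N c₁ c₂ J) 1 0 φ = φ)
    (hgen : Module.End.maxGenEigenspace (evolution (waveOp N c₁ c₂ J) 1 0 :
      (ZMod N → Fin d → ℂ) →ₗ[ℂ] (ZMod N → Fin d → ℂ)) 1 = Submodule.span ℂ {φ})
    {h : ℝ → Fin d → ℂ} (hp : Function.Periodic h 1)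
    (hd : ∀ ζ, HasDerivAt h (((-c₁ : ℝ) : ℂ) • (h (ζ + 1 / N) - (2 : ℂ) • h ζ + h (ζ - 1 / N)) +
      ((-c₂ : ℝ) : ℂ) • (J ζ).transpose.mulVec (h ζ)) ζ)
    (h0 : pair N (sample N h 0) φ = 0) : h = 0 := by
  have hsol : ∀ t, HasDerivAt (sample N h)
      (waveOp N (-c₁) (-c₂) (fun ζ => (J ζ).transpose) t (sample N h t)) t := fun t => by
    exact hasDerivAt_sample_homogeneous (J := fun ζ => (J ζ).transpose) hp hd t
  have hAc := continuous_waveOp N c₁ c₂ hJc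
  have hBc := continuous_waveOp N (-c₁) (-c₂) (J := fun ζ => (J ζ).transpose) hJc.matrix_transpose
  have hinv : ∀ x, pair N (sample N h 0) (evolution (waveOp N c₁ c₂ J) 1 0 x) =
      pair N (sample N h 0) x := fun x => by
    have h1 := pair_solution_eq hJ hsol (fun t => hasDerivAt_evolution_apply hAc x t 0) 1 0
    have h2 : sample N h 1 = sample N h 0 := by simpa using sample_periodic (N := N) hp 0
    rw [h2] at h1
    simpa [evolution_self] using h1
  -- The pairing vanishes on the range of S - Id by invariance and on φ by hypothesis, and these two
  -- span the space.
  have hz : sample N h 0 = 0 := by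
    refine eq_zero_of_pair_left fun y => ?_
    obtain ⟨x, c, rfl⟩ := exists_eq_sub_self_add_smul hφ hSφ hgen y
    rw [pair_add_right, pair_sub_right, pair_smul_right, h0]
    simp [hinv]
  have hzero := linearODE_unique hBc hsol (W := fun _ => 0)
    (fun t => by simpa using hasDerivAt_const t (0 : ZMod N → Fin d → ℂ)) (t₀ := 0) hz
  funext ζ
  have h1 := congrFun (congrFun hzero ζ) 0
  simpa [sample] using h1

/-- Solvability of the inhomogeneous linearized equation by a periodic function, when the
forcing is orthogonal to the adjoint mode. -/
theorem exists_periodic_solution_of_inner01_eq_zero {c₁ c₂ : ℝ}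
    {J : ℝ → Matrix (Fin d) (Fin d) ℂ} (hJc : Continuous J)
    (hJ : ∀ t a b, conj (J t a b) = J t a b)
    {φ : ZMod N → Fin d → ℂ} (hφ : φ ≠ 0) (hSφ : evolution (waveOp N c₁ c₂ J) 1 0 φ = φ)
    (hgen : Module.End.maxGenEigenspace (evolution (waveOp N c₁ c₂ J) 1 0 :
      (ZMod N → Fin d → ℂ) →ₗ[ℂ] (ZMod N → Fin d → ℂ)) 1 = Submodule.span ℂ {φ})
    {W : ℝ → ZMod N → Fin d → ℂ} (hWp : Function.Periodic W 1) (hWφ : pair N (W 0) φ = 1)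
    (hW : ∀ t, HasDerivAt W (waveOp N (-c₁) (-c₂) (fun ζ => (J ζ).transpose) t (W t)) t)
    {h : ℝ → Fin d → ℂ} (hp : Function.Periodic h 1) (hc : Continuous h)
    (horth : inner01 (unsample N W) h = 0) :
    ∃ Z : ℝ → ZMod N → Fin d → ℂ, Z 1 = Z 0 ∧
      ∀ t, HasDerivAt Z (waveOp N c₁ c₂ J t (Z t) + sample N h t) t := by
  have hAc := continuous_waveOp N c₁ c₂ hJc
  have hWc : Continuous W := continuous_iff_continuousAt.2 fun t => (hW t).continuousAt
  have hW1 : W 1 = W 0 := by simpa using hWp 0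
  obtain ⟨V, hV0, hV⟩ := exists_solution_inhomogeneous hAc (continuous_sample (N := N) hc)
  have hpc : Continuous fun t => pair N (W t) (sample N h t) := by
    have hs := continuous_sample (N := N) hc
    refine continuous_finsetSum _ fun j _ => continuous_finsetSum _ fun a _ => ?_
    exact (Complex.continuous_conj.comp ((continuous_apply a).comp
      ((continuous_apply j).comp hWc))).mul ((continuous_apply a).comp
      ((continuous_apply j).comp hs))
  -- Since V(0) = 0 and W is periodic, ⟨W(0), V(1)⟩ is the integral of ⟨W, h⟩ over a period, which
  -- is zero by orthogonality. Hence V(1) has no component along φ, and the mismatch can be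
  -- corrected.
  have hint := intervalIntegral.integral_eq_sub_of_hasDerivAt (a := 0) (b := 1)
    (fun t _ => hasDerivAt_pair_adjoint hJ (hW t) (hV t)) (hpc.intervalIntegrable _ _)
  rw [← inner01_unsample hWp hWc hp hc, horth, hV0, hW1] at hint
  have hpV : pair N (W 0) (V 1) = 0 := by
    have h0 : pair N (W 0) 0 = 0 := by simp [pair]
    rw [h0, sub_zero] at hint
    exact hint.symm
  obtain ⟨x, c, hx⟩ := exists_eq_sub_self_add_smul hφ hSφ hgen (V 1)
  have hinv : pair N (W 0) (evolution (waveOp N c₁ c₂ J) 1 0 x) = pair N (W 0) x := by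
    have h1 := pair_solution_eq hJ hW (fun t => hasDerivAt_evolution_apply hAc x t 0) 1 0
    rw [hW1] at h1
    simpa [evolution_self] using h1
  have hc0 : c = 0 := by
    rw [hx, pair_add_right, pair_sub_right, pair_smul_right, hWφ] at hpV
    simpa [hinv] using hpV
  rw [hc0, zero_smul, add_zero] at hx
  exact exists_periodic_solution_inhomogeneous hAc hV0 hV hx.symm

/-- The superposition of the components of a normalized periodic solution of the adjoint lattice
equation is the adjoint mode. -/
theorem isAdjointMode_unsample {μ ω : ℝ} {f : (Fin d → ℝ) → Fin d → ℝ} {u : ℝ → Fin d → ℝ}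
    (hω : ω ≠ 0) (hJc : Continuous fun ζ => jac f (u ζ))
    (hJp : Function.Periodic (fun ζ => jac f (u ζ)) 1)
    {v : ℝ → Fin d → ℂ} (hv : v = fun ζ => toC (deriv u ζ)) (hvp : Function.Periodic v 1)
    (hφd : ∀ t, HasDerivAt (sample N v)
      (waveOp N (μ / ω) (1 / ω) (fun ζ => jac f (u ζ)) t (sample N v t)) t)
    (hφne : sample N v 0 ≠ 0)
    (hgen : Module.End.maxGenEigenspace
      (evolution (waveOp N (μ / ω) (1 / ω) (fun ζ => jac f (u ζ))) 1 0 :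
        (ZMod N → Fin d → ℂ) →ₗ[ℂ] (ZMod N → Fin d → ℂ)) 1 = Submodule.span ℂ {sample N v 0})
    {W : ℝ → ZMod N → Fin d → ℂ} (hWp : Function.Periodic W 1)
    (hWφ : pair N (W 0) (sample N v 0) = 1)
    (hW : ∀ t, HasDerivAt W
      (waveOp N (-(μ / ω)) (-(1 / ω)) (fun ζ => (jac f (u ζ)).transpose) t (W t)) t)
    (hvc : Continuous v) :
    IsAdjointMode μ f u (1 / N) ω (unsample N W) := by
  have hJr : ∀ t a b, conj (jac f (u t) a b) = jac f (u t) a b := fun t a b => conj_jac f (u t) a b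
  have hAc := continuous_waveOp N (μ / ω) (1 / ω) hJc
  have hSφ : evolution (waveOp N (μ / ω) (1 / ω) (fun ζ => jac f (u ζ))) 1 0 (sample N v 0) =
      sample N v 0 := by
    rw [← eq_evolution_apply hAc hφd]
    simpa using sample_periodic (N := N) hvp 0
  have hWc : Continuous W := continuous_iff_continuousAt.2 fun t => (hW t).continuousAt
  have hadp : Function.Periodic (unsample N W) 1 := unsample_periodic hWp
  have hadd := hasDerivAt_unsample hWp hW
  have hnorm : inner01 (unsample N W) v = 1 := by
    rw [inner01_unsample hWp hWc hvp hvc]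
    have : ∀ ζ, pair N (W ζ) (sample N v ζ) = 1 := fun ζ => by
      rw [← hWφ]; exact pair_solution_eq hJr hW hφd ζ 0
    simp [this]
  refine ⟨inKerAdjoint_of_hasDerivAt hω hJc hJp hadp hadd, fun y hy => ?_, hv ▸ hnorm⟩
  have hyd := hy.hasDerivAt hω hJc
  have hyp : Function.Periodic y 1 := by
    obtain ⟨g, hg, -⟩ := hy
    exact hg.periodic
  -- Sampling the superposition need not give back W, so ⟨W(0), φ⟩ = 1 does not settle this. A zero
  -- pairing would force the mode to vanish, against its L² normalization.
  have hpne : pair N (sample N (unsample N W) 0) (sample N v 0) ≠ 0 := fun h0 => by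
    have hz := adjoint_solution_eq_zero hJc hJr hφne hSφ hgen hadp hadd h0
    rw [hz] at hnorm
    simp [inner01] at hnorm
  set p := pair N (sample N (unsample N W) 0) (sample N v 0) with hp
  set q := pair N (sample N y 0) (sample N v 0) with hq
  -- The multiple of the mode with the same pairing against φ as y; the conjugate appears because
  -- the pairing is antilinear on the left.
  refine ⟨conj (q / p), ?_⟩
  rw [← sub_eq_zero]
  refine adjoint_solution_eq_zero hJc hJr hφne hSφ hgen
    (h := y - conj (q / p) • unsample N W) (fun ζ => ?_) (fun ζ => ?_) ?_
  · simp only [Pi.sub_apply, Pi.smul_apply, hyp ζ, hadp ζ]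
  · refine ((hyd ζ).sub ((hadd ζ).const_smul (conj (q / p)))).congr_deriv ?_
    simp only [Pi.sub_apply, Pi.smul_apply, Matrix.mulVec_sub, Matrix.mulVec_smul]
    module
  · have h1 : sample N (y - conj (q / p) • unsample N W) 0 =
        sample N y 0 - conj (q / p) • sample N (unsample N W) 0 := rfl
    rw [h1, pair_sub_left, pair_smul_left, Complex.conj_conj, ← hp, ← hq,
      div_mul_cancel₀ _ hpne, sub_self]

/-- The second order approximate eigenpair of the Bloch-Floquet operators built from the profile
derivatives `v = ∂_ζ u` and `w = ∂_k u`. -/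
theorem exists_approximate_bloch_eigenpair {c₁ c₂ : ℝ}
    {J : ℝ → Matrix (Fin d) (Fin d) ℂ} (hJc : Continuous J)
    (hJ : ∀ t a b, conj (J t a b) = J t a b) {v w : ℝ → Fin d → ℂ} {ν₁ ν₂ : ℂ}
    (hvp : Function.Periodic v 1) (hwp : Function.Periodic w 1)
    (hvd : ∀ ζ, HasDerivAt v ((c₁ : ℂ) • (v (ζ + 1 / N) - (2 : ℂ) • v ζ + v (ζ - 1 / N)) +
      (c₂ : ℂ) • (J ζ).mulVec (v ζ)) ζ)
    (hwd : ∀ ζ, HasDerivAt w ((c₁ : ℂ) • (w (ζ + 1 / N) - (2 : ℂ) • w ζ + w (ζ - 1 / N)) +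
      (c₂ : ℂ) • (J ζ).mulVec (w ζ) +
      ((c₁ : ℂ) • (v (ζ + 1 / N) - v (ζ - 1 / N)) - ν₁ • v ζ)) ζ)
    (hφne : sample N v 0 ≠ 0)
    (hgen : Module.End.maxGenEigenspace (evolution (waveOp N c₁ c₂ J) 1 0 :
      (ZMod N → Fin d → ℂ) →ₗ[ℂ] (ZMod N → Fin d → ℂ)) 1 = Submodule.span ℂ {sample N v 0})
    {W : ℝ → ZMod N → Fin d → ℂ} (hWp : Function.Periodic W 1)
    (hWφ : pair N (W 0) (sample N v 0) = 1)
    (hW : ∀ t, HasDerivAt W (waveOp N (-c₁) (-c₂) (fun ζ => (J ζ).transpose) t (W t)) t)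
    (horth : inner01 (unsample N W) (fun ζ => (c₁ : ℂ) • (w (ζ + 1 / N) - w (ζ - 1 / N)) +
      ((c₁ : ℂ) / 2) • (v (ζ + 1 / N) + v (ζ - 1 / N)) - ν₂ • v ζ - ν₁ • w ζ) = 0) :
    ∃ P : ℂ → ZMod N → Fin d → ℂ, Tendsto P (𝓝 0) (𝓝 (sample N v 0)) ∧
      (fun x : ℂ => evolution (fun t => waveOp N c₁ c₂ J t + blochPerturbation N d c₁ x) 1 0 (P x) -
        Complex.exp (ν₁ * x + ν₂ * x ^ 2) • P x) =O[𝓝 0] fun x => x ^ 3 := by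
  have hvc : Continuous v := continuous_iff_continuousAt.2 fun ζ => (hvd ζ).continuousAt
  have hwc : Continuous w := continuous_iff_continuousAt.2 fun ζ => (hwd ζ).continuousAt
  have hAc := continuous_waveOp N c₁ c₂ hJc
  have hφd := hasDerivAt_sample_homogeneous hvp hvd
  have hφ1 : sample N v 1 = sample N v 0 := by simpa using sample_periodic (N := N) hvp 0
  have hw1 : sample N w 1 = sample N w 0 := by simpa using sample_periodic (N := N) hwp 0
  have hSφ : evolution (waveOp N c₁ c₂ J) 1 0 (sample N v 0) = sample N v 0 := by
    rw [← eq_evolution_apply hAc hφd, hφ1]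
  set h : ℝ → Fin d → ℂ := fun ζ => (c₁ : ℂ) • (w (ζ + 1 / N) - w (ζ - 1 / N)) +
    ((c₁ : ℂ) / 2) • (v (ζ + 1 / N) + v (ζ - 1 / N)) - ν₂ • v ζ - ν₁ • w ζ with hh
  have hhc : Continuous h := by
    have hvk : Continuous fun ζ : ℝ => v (ζ + 1 / N) := hvc.comp (by fun_prop)
    have hvk' : Continuous fun ζ : ℝ => v (ζ - 1 / N) := hvc.comp (by fun_prop)
    have hwk : Continuous fun ζ : ℝ => w (ζ + 1 / N) := hwc.comp (by fun_prop)
    have hwk' : Continuous fun ζ : ℝ => w (ζ - 1 / N) := hwc.comp (by fun_prop)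
    fun_prop
  have hhp : Function.Periodic h 1 := fun ζ => by
    have e1 : ζ + 1 + 1 / (N : ℝ) = ζ + 1 / N + 1 := by ring
    have e2 : ζ + 1 - 1 / (N : ℝ) = ζ - 1 / N + 1 := by ring
    simp only [hh, e1, e2, hvp _, hwp _]
  obtain ⟨Z, hZ1, hZ⟩ := exists_periodic_solution_of_inner01_eq_zero hJc hJ hφne hSφ hgen hWp hWφ
    hW hhp hhc horth
  -- The first order corrector is explicit: the samples of ∂_k u. Only the second order corrector Z
  -- comes from the Fredholm alternative.
  have hV₁ : ∀ t, HasDerivAt (sample N w) (waveOp N c₁ c₂ J t (sample N w t) +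
      (((c₁ : ℂ) • (shift N 1 - shift N (-1)) :
        (ZMod N → Fin d → ℂ) →L[ℂ] (ZMod N → Fin d → ℂ)) (sample N v t) -
        ν₁ • sample N v t)) t := fun t => by
    refine (hasDerivAt_sample hwp hwd t).congr_deriv ?_
    congr 1
    funext j
    simp only [smul_apply, sub_apply, Pi.smul_apply, Pi.sub_apply,
      shift_apply, ← sub_eq_add_neg, sample_add_one hvp, sample_sub_one hvp]
    rfl
  have hV₂ : ∀ t, HasDerivAt Z (waveOp N c₁ c₂ J t (Z t) +
      (((c₁ : ℂ) • (shift N 1 - shift N (-1)) :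
        (ZMod N → Fin d → ℂ) →L[ℂ] (ZMod N → Fin d → ℂ)) (sample N w t) +
      (((c₁ : ℂ) / 2) • (shift N 1 + shift N (-1)) :
        (ZMod N → Fin d → ℂ) →L[ℂ] (ZMod N → Fin d → ℂ)) (sample N v t) -
        ν₂ • sample N v t - ν₁ • sample N w t)) t := fun t => by
    refine (hZ t).congr_deriv ?_
    congr 1
    funext j
    simp only [smul_apply, sub_apply, add_apply, Pi.smul_apply, Pi.sub_apply, Pi.add_apply,
      shift_apply, ← sub_eq_add_neg, sample_add_one hvp, sample_sub_one hvp,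
      sample_add_one hwp, sample_sub_one hwp]
    rfl
  refine ⟨fun x => sample N v 0 + x • sample N w 0 + x ^ 2 • Z 0, ?_,
    approximate_floquet_eigenpair hAc (fun x hx => norm_blochPerturbation_sub_le N c₁ hx)
      hφd hV₁ hV₂ hφ1 hw1 hZ1⟩
  have : Continuous fun x : ℂ => sample N v 0 + x • sample N w 0 + x ^ 2 • Z 0 := by fun_prop
  simpa using this.tendsto 0

end Main

end LatticeRD

end

/-! ### The critical Floquet multiplier of a nondegenerate wave -/

theorem theorem4p1 {d : ℕ} (N : ℕ) [NeZero N] (μ : ℝ)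
    (f : (Fin d → ℝ) → Fin d → ℝ) (hf : ContDiff ℝ ((⊤ : ℕ∞) : WithTop ℕ∞) f)
    (I : Set ℝ) (hI : IsOpen I) (hk : (1 / N : ℝ) ∈ I)
    (u : ℝ → ℝ → Fin d → ℝ) (ω : ℝ → ℝ)
    (hfam : LatticeRD.IsWaveFamily μ f I u ω)
    (hω : ω (1 / N) ≠ 0)
    (hA : LatticeRD.Nondegenerate N μ f (u (1 / N)) (ω (1 / N))) :
    ∃ uad : ℝ → Fin d → ℂ,
      LatticeRD.IsAdjointMode μ f (u (1 / N)) (1 / N) (ω (1 / N)) uad ∧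
      ∃ ε₀ : ℝ, 0 < ε₀ ∧ ∃ ξ₀ ∈ Set.Ioo (0 : ℝ) (Real.pi / N), ∃ lam : ℝ → ℂ,
        AnalyticOnNhd ℝ lam (Set.Icc (-ξ₀) ξ₀) ∧
        (∀ ξ ∈ Set.Icc (-ξ₀) ξ₀,
          spectrum ℂ (LatticeRD.floquet N μ f (u (1 / N)) (ω (1 / N)) ξ) ∩ Metric.ball 1 ε₀
            = {lam ξ}) ∧
        (∀ ξ ∈ Set.Icc (-ξ₀) ξ₀,
          Module.finrank ℂ (LatticeRD.genEigenspace N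
            (LatticeRD.floquet N μ f (u (1 / N)) (ω (1 / N)) ξ) (lam ξ)) = 1) ∧
        (LatticeRD.inner01 uad (LatticeRD.dk u (1 / N)) = 0 →
          (fun ξ : ℝ => lam ξ - Complex.exp ((1 / ((ω (1 / N) : ℝ) : ℂ)) *
              (Complex.I * ξ * ((deriv ω (1 / N) : ℝ) : ℂ) +
                (Complex.I * ξ) ^ 2 * LatticeRD.diffusionCoeff μ u (1 / N) uad)))
            =O[𝓝 0] fun ξ : ℝ => |ξ| ^ 3) := by
  have hJc := LatticeRD.continuous_jac hf (hfam.continuous_profile hI hk)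
  have hJp : Function.Periodic (fun ζ => LatticeRD.jac f (u (1 / N) ζ)) 1 := fun ζ =>
    congrArg (LatticeRD.jac f) (hfam.periodic _ hk ζ)
  have hJr : ∀ t a b, (starRingEnd ℂ) (LatticeRD.jac f (u (1 / N) t) a b) =
      LatticeRD.jac f (u (1 / N) t) a b := fun t a b => LatticeRD.conj_jac f (u (1 / N) t) a b
  have hvp := hfam.periodic_dζ hk
  have hwp := hfam.periodic_dk hI hk
  have hvd := hfam.hasDerivAt_dζ hI hk hf hω
  have hwd := hfam.hasDerivAt_dk hI hk hf hω
  have hvc : Continuous (LatticeRD.dζ u (1 / N)) :=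
    continuous_iff_continuousAt.2 fun ζ => (hvd ζ).continuousAt
  have hwc : Continuous (LatticeRD.dk u (1 / N)) :=
    continuous_iff_continuousAt.2 fun ζ => (hwd ζ).continuousAt
  have hAc := LatticeRD.continuous_waveOp N (μ / ω (1 / N)) (1 / ω (1 / N)) hJc
  have hφd := LatticeRD.hasDerivAt_sample_homogeneous (N := N)
    (J := fun ζ => LatticeRD.jac f (u (1 / N) ζ)) hvp hvd
  have hφ0 : LatticeRD.sample N (LatticeRD.dζ u (1 / N)) 0 =
      LatticeRD.translationMode N (u (1 / N)) := by
    funext j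
    simp only [LatticeRD.sample, LatticeRD.translationMode, LatticeRD.dζ]
    congr 2
    ring
  have hφne : LatticeRD.sample N (LatticeRD.dζ u (1 / N)) 0 ≠ 0 := hφ0 ▸ hA.1
  have hSφ : LatticeRD.evolution (LatticeRD.waveOp N (μ / ω (1 / N)) (1 / ω (1 / N))
      fun ζ => LatticeRD.jac f (u (1 / N) ζ)) 1 0 (LatticeRD.sample N (LatticeRD.dζ u (1 / N)) 0) =
      LatticeRD.sample N (LatticeRD.dζ u (1 / N)) 0 := by
    rw [← LatticeRD.eq_evolution_apply hAc hφd]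
    simpa using LatticeRD.sample_periodic (N := N) hvp 0
  -- The Floquet operators extended to complex x; the line x = iξ recovers the real Floquet
  -- exponents.
  set S : ℂ → (ZMod N → Fin d → ℂ) →L[ℂ] (ZMod N → Fin d → ℂ) := fun x =>
    LatticeRD.evolution (fun t => LatticeRD.waveOp N (μ / ω (1 / N)) (1 / ω (1 / N))
      (fun ζ => LatticeRD.jac f (u (1 / N) ζ)) t +
        LatticeRD.blochPerturbation N d (μ / ω (1 / N)) x) 1 0 with hSdef
  have hfloq : ∀ ξ : ℝ, LatticeRD.floquet N μ f (u (1 / N)) (ω (1 / N)) ξ = S (Complex.I * ξ) :=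
    fun ξ => LatticeRD.floquet_eq_evolution N μ f (u (1 / N)) hω hJc ξ
  have hS0 : S 0 = LatticeRD.evolution (LatticeRD.waveOp N (μ / ω (1 / N)) (1 / ω (1 / N))
      fun ζ => LatticeRD.jac f (u (1 / N) ζ)) 1 0 := by
    simp only [hSdef, LatticeRD.blochPerturbation_zero, add_zero]
  have hgenS : Module.End.maxGenEigenspace
      (S 0 : (ZMod N → Fin d → ℂ) →ₗ[ℂ] (ZMod N → Fin d → ℂ)) 1 =
      Submodule.span ℂ {LatticeRD.sample N (LatticeRD.dζ u (1 / N)) 0} := by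
    have h := hA.2
    rw [hfloq 0, Complex.ofReal_zero, mul_zero, ← hφ0] at h
    exact h
  have hgen := hgenS
  rw [hS0] at hgen
  have hSd : Differentiable ℂ S := LatticeRD.differentiable_evolution
    (LatticeRD.waveOp_add_blochPerturbation_mem_holoContSpan N _ _ hJc) 1 0
  obtain ⟨W, hWp, hWφ, hW⟩ :=
    LatticeRD.exists_periodic_adjoint_solution hJc hJp hJr hφne hSφ hgen
  have hmode : LatticeRD.IsAdjointMode μ f (u (1 / N)) (1 / N) (ω (1 / N))
      (LatticeRD.unsample N W) :=
    LatticeRD.isAdjointMode_unsample hω hJc hJp rfl hvp hφd hφne hgen hWp hWφ hW hvc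
  refine ⟨LatticeRD.unsample N W, hmode, ?_⟩
  obtain ⟨ε, hε, δ, hδ, lam, hlam, happrox⟩ := LatticeRD.exists_eigenvalue_curve hSd hφne hgenS
  have hN : (0 : ℝ) < N := Nat.cast_pos.2 (NeZero.pos N)
  have hπ : 0 < Real.pi / N := div_pos Real.pi_pos hN
  -- Halving δ keeps the closed interval inside the open disc of radius δ; halving π/N makes the
  -- second bound strict.
  refine ⟨ε, hε, min (δ / 2) (Real.pi / N / 2), ⟨lt_min (half_pos hδ) (half_pos hπ),
    (min_le_right _ _).trans_lt (half_lt_self hπ)⟩, fun ξ => lam (Complex.I * ξ), ?_⟩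
  have hsmall : ∀ ξ ∈ Set.Icc (-min (δ / 2) (Real.pi / N / 2)) (min (δ / 2) (Real.pi / N / 2)),
      ‖Complex.I * (ξ : ℂ)‖ < δ := fun ξ hξ => by
    rw [norm_mul, Complex.norm_I, one_mul, Complex.norm_real, Real.norm_eq_abs]
    exact (abs_le.2 hξ).trans_lt ((min_le_left _ _).trans_lt (half_lt_self hδ))
  refine ⟨fun ξ hξ => ?_, fun ξ hξ => ?_, fun ξ hξ => ?_, fun hw0 => ?_⟩
  · have h1 : AnalyticAt ℝ lam (Complex.I * ξ) := (hlam _ (hsmall ξ hξ)).1.restrictScalars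
    have h2 : AnalyticAt ℝ (fun ξ : ℝ => Complex.I * (ξ : ℂ)) ξ :=
      analyticAt_const.mul (Complex.ofRealCLM.analyticAt ξ)
    exact AnalyticAt.comp (g := lam) (f := fun ξ : ℝ => Complex.I * (ξ : ℂ)) h1 h2
  · rw [hfloq]
    exact (hlam _ (hsmall ξ hξ)).2.1
  · rw [hfloq]
    exact (hlam _ (hsmall ξ hξ)).2.2
  · set D := LatticeRD.diffusionCoeff μ u (1 / N) (LatticeRD.unsample N W) with hD
    have hWc : Continuous W := continuous_iff_continuousAt.2 fun t => (hW t).continuousAt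
    have horth := LatticeRD.inner01_second_order_forcing (μ := μ) (ω₀ := ω (1 / N))
      (ν₁ := ((deriv ω (1 / N) / ω (1 / N) : ℝ) : ℂ)) (LatticeRD.continuous_unsample hWc)
      hvc hwc hmode.2.2 hw0
    obtain ⟨P, hP, hres⟩ := LatticeRD.exists_approximate_bloch_eigenpair hJc hJr hvp hwp hvd hwd
      hφne hgen hWp hWφ hW horth
    have hz : Filter.Tendsto (fun x : ℂ => Complex.exp
        (((deriv ω (1 / N) / ω (1 / N) : ℝ) : ℂ) * x + ((1 / ω (1 / N) : ℝ) : ℂ) * D * x ^ 2))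
        (𝓝 0) (𝓝 1) := by
      have : Continuous fun x : ℂ => Complex.exp
        (((deriv ω (1 / N) / ω (1 / N) : ℝ) : ℂ) * x + ((1 / ω (1 / N) : ℝ) : ℂ) * D * x ^ 2) := by
        fun_prop
      simpa using this.tendsto 0
    -- The approximate multiplier exp(ν₁x + ν₂x²), with ν₁ = ω'/ω and ν₂ = D/ω, is within O(x³) of
    -- the eigenvalue curve; it remains to put x = iξ.
    have hO := happrox _ _ _ hz hP hres
    have hI0 : Filter.Tendsto (fun ξ : ℝ => Complex.I * (ξ : ℂ)) (𝓝 0) (𝓝 0) := by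
      have : Continuous fun ξ : ℝ => Complex.I * (ξ : ℂ) := by fun_prop
      simpa using this.tendsto 0
    refine ((hO.comp_tendsto hI0).congr_left fun ξ => ?_).trans (Asymptotics.IsBigO.of_bound 1
      (Filter.Eventually.of_forall fun ξ => ?_))
    · simp only [Function.comp]
      congr 2
      push_cast
      ring
    · simp
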